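/- For $k\ge 1$ let $|\Phi_k^+\rangle=\frac1{\sqrt k}\sum_{l=0}^{k-1}|l\rangle\otimes|l\rangle\in\mathbb C^k\otimes\mathbb C^k$, and let $X_k=\sum_l|l+1 \bmod k\rangle\langle l|$ and $Z_k=\sum_l e^{2\pi i l/k}|l\rangle\langle l|$ be the generalized Pauli operators. Let $\gamma_1,\gamma_2$ be nonreal complex numbers with $|\gamma_1|=|\gamma_2|=1$ and $\gamma_2\neq\pm i\gamma_1^2$. Decompose $\mathbb C^{11}=\mathbb C^2\oplus\mathbb C^9$ and define states of $\mathbb C^{11}\otimes\mathbb C^{11}$ shared by two parties $A$ and $B$ by $$|\psi_0\rangle=\sqrt{\tfrac2{11}}\,|\Phi_2^+\rangle\oplus\sqrt{\tfrac9{11}}\,|\Phi_9^+\rangle,$$ $$|\psi_1\rangle=\sqrt{\tfrac2{11}}\,\gamma_1(X_2\otimes 1)|\Phi_2^+\rangle\oplus\sqrt{\tfrac9{11}}\,(X_9^3\otimes 1)|\Phi_9^+\rangle,$$ $$|\psi_2\rangle=\sqrt{\tfrac2{11}}\,\gamma_2(Z_2\otimes 1)|\Phi_2^+\rangle\oplus\sqrt{\tfrac9{11}}\,(X_9^6\otimes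 1)|\Phi_9^+\rangle,$$ and let $|\psi\rangle^{RAB}=\frac1{\sqrt3}\sum_{l=0}^2|l\rangle^R\otimes|\psi_l\rangle^{AB}$, where $R$ is a reference system. Definitions. An $r$-round LOCC map is a map realised by a protocol with $r$ rounds, in each of which one party, fixed for that round, performs a local measurement with finitely many outcomes that may depend on all earlier outcomes, and announces its outcome; at the end each party performs a local measurement that depends on all announced outcomes, and all outcomes are forgotten. Local input and output systems may have different dimensions. One-way LOCC is one-round LOCC (one-way from $A$ to $B$ if $A$ announces), and two-way LOCC is LOCC that is not one-way. Non-catalytic approximate state merging of $|\psi\rangle^{RAB}$ within $\epsilon\ge0$ by a protocol of a given class, with entanglement cost $\log_2K$ for an integer $K\ge1$, means an LOCC map $\mathcal M$ of that class from $(A\bar A)(B\bar B)$ to $B'B$ (all outputs held by $B$, where $B'$ is a copy of $A$) that satisfies $$\langle\psi|^{RB'B}\,(\mathrm{id}^R\otimes\mathcal M)\big(|\psi\rangle\langle\psi|^{RAB}\otimes|\Phi_K^+\rangle\langle\Phi_K^+|^{\bar A\bar B}\big)\,|\psi\rangle^{RB'B}\ \ge\ 1-\epsilon^2 .$$ Theorem.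 The states $|\psi_0\rangle,|\psi_1\rangle,|\psi_2\rangle$ are orthonormal, and there is $\epsilon_0>0$ such that for every $\epsilon\in[0,\epsilon_0]$ the following hold. 1. The minimal entanglement cost of non-catalytic approximate state merging of $|\psi\rangle^{RAB}$ within $\epsilon$ by one-way LOCC is exactly one ebit, $\log_2K=1$. This holds both for one-way LOCC from $A$ to $B$ and for one-way LOCC in which either party may be the one that announces. 2. The minimal entanglement cost by two-way LOCC is zero, $\log_2K=0$. It is achieved by a two-way LOCC protocol with two rounds, in which first $B$ makes a $3$-outcome measurement and announces the outcome, then $A$ makes a $33$-outcome measurement that depends on the outcome of $B$ and announces the outcome, and finally the parties perform local operations that depend on both outcomes. -/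

import Mathlib

open scoped Matrix Kronecker ComplexConjugate

noncomputable section

namespace StateMerging

/-! ### Local operations and classical communication

A finite-dimensional system is given by the finite type that labels its computational basis;
composite systems are labelled by product types, direct sums by sum types. -/

/-- A family of measurement operators from a system `a` to a system `a'`, with the completeness
condition `∑ i, (M i)† (M i) = 1`. The output system may differ from the input system: adding
and discarding auxiliary systems is allowed. -/
def IsMeasurement {ι a a' : Type} [Fintype ι] [Fintype a] [DecidableEq a] [Fintype a']
    (M : ι → Matrix a' a ℂ) : Prop :=
  ∑ i, (M i)ᴴ * M i = 1

/-- The two parties that perform the protocol: the sender `A` and the receiver `B`. -/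
inductive Party : Type
  | A
  | B

/-- Maps on operators of a bipartite system `a × b` (the first factor is held by `A`, the second
by `B`), with outputs on `a' × b'`. The predicates below only hold for maps that are
given by finitely many Kraus operators, so linearity is not recorded separately. -/
abbrev BipartiteMap (a b a' b' : Type) : Type :=
  Matrix (a × b) (a × b) ℂ → Matrix (a' × b') (a' × b') ℂ

/-- `IsLOCC s Λ`: the map `Λ` is realised by an LOCC protocol whose rounds of communication are
listed in `s`. An entry `(v, n)` of `s` is a round in which the party `v` performs an `n`-outcome
measurement, which may depend on all earlier outcomes, and announces its outcome to the other
party. After the last round each party performs a local measurement that depends on all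
announced outcomes. In the end all the outcomes are forgotten. -/
def IsLOCC : List (Party × ℕ) → ∀ {a b a' b' : Type} [Fintype a] [DecidableEq a]
    [Fintype b] [DecidableEq b] [Fintype a'] [Fintype b'], BipartiteMap a b a' b' → Prop
  | [], a, b, a', b', _, _, _, _, _, _, Λ =>
      ∃ (p q : ℕ) (M : Fin p → Matrix a' a ℂ) (N : Fin q → Matrix b' b ℂ),
        IsMeasurement M ∧ IsMeasurement N ∧
        ∀ ρ, Λ ρ = ∑ i, ∑ j, (M i ⊗ₖ N j) * ρ * (M i ⊗ₖ N j)ᴴ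
  | (Party.A, n) :: s, a, b, a', b', _, _, _, _, _, _, Λ =>
      ∃ (c : ℕ) (M : Fin n → Matrix (Fin c) a ℂ) (Λ' : Fin n → BipartiteMap (Fin c) b a' b'),
        IsMeasurement M ∧ (∀ m, IsLOCC s (Λ' m)) ∧
        ∀ ρ, Λ ρ = ∑ m, Λ' m ((M m ⊗ₖ (1 : Matrix b b ℂ)) * ρ * (M m ⊗ₖ (1 : Matrix b b ℂ))ᴴ)
  | (Party.B, n) :: s, a, b, a', b', _, _, _, _, _, _, Λ =>
      ∃ (c : ℕ) (M : Fin n → Matrix (Fin c) b ℂ) (Λ' : Fin n → BipartiteMap a (Fin c) a' b'),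
        IsMeasurement M ∧ (∀ m, IsLOCC s (Λ' m)) ∧
        ∀ ρ, Λ ρ = ∑ m, Λ' m (((1 : Matrix a a ℂ) ⊗ₖ M m) * ρ * ((1 : Matrix a a ℂ) ⊗ₖ M m)ᴴ)

/-- A class of maps between operators on bipartite systems, such as one-way LOCC. -/
abbrev MapClass : Type 1 :=
  ∀ (a b a' b' : Type) [Fintype a] [DecidableEq a] [Fintype b] [DecidableEq b] [Fintype a']
    [Fintype b'], BipartiteMap a b a' b' → Prop

/-- Maps that are realised by an LOCC protocol with rounds `s`. -/
def LOCCWithRounds (s : List (Party × ℕ)) : MapClass :=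
  fun _ _ _ _ _ _ _ _ _ _ Λ => IsLOCC s Λ

/-- One-way LOCC in which the only communication is from the party `v` to the other party. -/
def OneWayLOCCFrom (v : Party) : MapClass :=
  fun _ _ _ _ _ _ _ _ _ _ Λ => ∃ n : ℕ, IsLOCC [(v, n)] Λ

/-- One-way LOCC: one round of communication, from either party. -/
def OneWayLOCC : MapClass :=
  fun a b a' b' _ _ _ _ _ _ Λ => ∃ v : Party, OneWayLOCCFrom v a b a' b' Λ

/-- Two-way LOCC: maps realised by a (finite-round) LOCC protocol that are not one-way LOCC. -/
def TwoWayLOCC : MapClass :=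
  fun a b a' b' _ _ _ _ _ _ Λ =>
    (∃ s : List (Party × ℕ), IsLOCC s Λ) ∧ ¬ OneWayLOCC a b a' b' Λ

/-! ### State merging -/

/-- The operator `|φ⟩⟨φ|`. -/
def ketBra {x : Type} (φ : x → ℂ) : Matrix x x ℂ :=
  Matrix.vecMulVec φ (star φ)

/-- The map `id ⊗ Λ` on operators of `r × x`, for a linear map `Λ` from operators of `x` to
operators of `y`. -/
def idTensor (r : Type) {x y : Type} (Λ : Matrix x x ℂ → Matrix y y ℂ)
    (ρ : Matrix (r × x) (r × x) ℂ) : Matrix (r × y) (r × y) ℂ :=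
  fun u v => Λ (fun s t => ρ (u.1, s) (v.1, t)) u.2 v.2

/-- The squared fidelity `⟨φ|ρ|φ⟩` of an operator `ρ` with a pure state `φ`. -/
def fidelitySq {x : Type} [Fintype x] (ρ : Matrix x x ℂ) (φ : x → ℂ) : ℝ :=
  (star φ ⬝ᵥ (ρ *ᵥ φ)).re

/-- The maximally entangled state `(1/√K) ∑ l, |l⟩ ⊗ |l⟩`. -/
def maxEntangled (K : ℕ) : Fin K × Fin K → ℂ :=
  fun p => if p.1 = p.2 then ((√(K : ℝ) : ℝ) : ℂ)⁻¹ else 0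

section
variable {r a b : Type}

/-- The initial state `|ψ⟩ ⊗ |Φ_K⟩` on `R`, `(A, Ā)`, `(B, B̄)`. -/
def initialState (ψ : r × a × b → ℂ) (K : ℕ) : r × ((a × Fin K) × (b × Fin K)) → ℂ :=
  fun t => ψ (t.1, t.2.1.1, t.2.2.1) * maxEntangled K (t.2.1.2, t.2.2.2)

/-- The target state `|ψ⟩ ⊗ |Φ_L⟩` on `R`, `Ā`, `((B', B), B̄)`, where `B'` is a copy of `A`
held by the party `B`. -/
def targetState (ψ : r × a × b → ℂ) (L : ℕ) : r × (Fin L × ((a × b) × Fin L)) → ℂ :=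
  fun t => ψ (t.1, t.2.2.1.1, t.2.2.1.2) * maxEntangled L (t.2.1, t.2.2.2)

/-- `Λ` achieves approximate state merging of `ψ` within `ε`, consuming a maximally entangled
state of Schmidt rank `K` and returning one of Schmidt rank `L`. -/
def AchievesMerging [Fintype r] [Fintype a] [Fintype b] (ψ : r × a × b → ℂ) (K L : ℕ) (ε : ℝ)
    (Λ : BipartiteMap (a × Fin K) (b × Fin K) (Fin L) ((a × b) × Fin L)) : Prop :=
  1 - ε ^ 2 ≤ fidelitySq (idTensor r Λ (ketBra (initialState ψ K))) (targetState ψ L)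

/-- The entanglement costs `log₂ K` of the protocols in the class `𝒞` for non-catalytic (`L = 1`)
approximate state merging of `ψ` within `ε`. -/
def nonCatalyticCosts [Fintype r] [Fintype a] [DecidableEq a] [Fintype b] [DecidableEq b]
    (𝒞 : MapClass) (ψ : r × a × b → ℂ) (ε : ℝ) : Set ℝ :=
  {c | ∃ K : ℕ, 0 < K ∧ c = Real.logb 2 K ∧
    ∃ Λ : BipartiteMap (a × Fin K) (b × Fin K) (Fin 1) ((a × b) × Fin 1),
      𝒞 _ _ _ _ Λ ∧ AchievesMerging ψ K 1 ε Λ}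

end

/-! ### The state -/

/-- The generalized Pauli operator `X = ∑ l, |l + 1 mod k⟩⟨l|`. -/
def pauliX (k : ℕ) [NeZero k] : Matrix (Fin k) (Fin k) ℂ :=
  fun i j => if i = j + 1 then 1 else 0

/-- The generalized Pauli operator `Z = ∑ l, exp(2πil/k) |l⟩⟨l|`. -/
def pauliZ (k : ℕ) : Matrix (Fin k) (Fin k) ℂ :=
  Matrix.diagonal fun l => Complex.exp (2 * Real.pi * Complex.I * (l : ℕ) / k)

/-- `M` applied to the first half of the maximally entangled state of `ℂ^k ⊗ ℂ^k`. -/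
def onMaxEntangled {k : ℕ} (M : Matrix (Fin k) (Fin k) ℂ) : Fin k × Fin k → ℂ :=
  (M ⊗ₖ (1 : Matrix (Fin k) (Fin k) ℂ)) *ᵥ maxEntangled k

/-- The label set of the computational basis of `ℂ^11 = ℂ^2 ⊕ ℂ^9`. -/
abbrev C11 : Type := Fin 2 ⊕ Fin 9

/-- The direct sum `√(2/11) u ⊕ √(9/11) v` in `(ℂ^2 ⊕ ℂ^9) ⊗ (ℂ^2 ⊕ ℂ^9)` of vectors
`u` of `ℂ^2 ⊗ ℂ^2` and `v` of `ℂ^9 ⊗ ℂ^9`. -/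
def weightedSum (u : Fin 2 × Fin 2 → ℂ) (v : Fin 9 × Fin 9 → ℂ) : C11 × C11 → ℂ
  | (Sum.inl i, Sum.inl j) => ((√(2 / 11 : ℝ) : ℝ) : ℂ) * u (i, j)
  | (Sum.inr i, Sum.inr j) => ((√(9 / 11 : ℝ) : ℝ) : ℂ) * v (i, j)
  | _ => 0

/-- The three bipartite states `|ψ_l⟩` on `ℂ^11 ⊗ ℂ^11`. -/
def psiAB (γ₁ γ₂ : ℂ) : Fin 3 → C11 × C11 → ℂ :=
  ![weightedSum (maxEntangled 2) (maxEntangled 9),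
    weightedSum (γ₁ • onMaxEntangled (pauliX 2)) (onMaxEntangled (pauliX 9 ^ 3)),
    weightedSum (γ₂ • onMaxEntangled (pauliZ 2)) (onMaxEntangled (pauliX 9 ^ 6))]

/-- The tripartite state `(1/√3) ∑ l, |l⟩ ⊗ |ψ_l⟩` on `R`, `A`, `B`. -/
def psiRAB (γ₁ γ₂ : ℂ) : Fin 3 × C11 × C11 → ℂ :=
  fun t => ((√(3 : ℝ) : ℝ) : ℂ)⁻¹ * psiAB γ₁ γ₂ t.1 t.2

end StateMerging

end

open StateMerging

open scoped Matrix Kronecker ComplexConjugate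

noncomputable section

namespace StateMerging

/-! Since `A` keeps nothing, only the row vectors `φ` that `A` applies matter: merging is possible
exactly when each `φ` leaves `B` with orthogonal vectors of equal norm for the three `ψ_l`, which
`B` can then rotate to the target. Let `X, Y, Z` be the Bloch coordinates of the part of `φ` on
`ℂ^2`, and let `t` be the autocorrelation at lag 3 of its part on `ℂ^9`. Up to scaling, the overlaps
of the three vectors are `γ₁X + t`, `γ₂Z + conj t` and `-i (conj γ₁) γ₂ Y + t`.

One-way lower bound. With `K = 1`, suppose all three overlaps vanish. Eliminating `t` gives `X + βY
= 0` with `β = i (conj γ₁)² γ₂`, which is nonreal because `γ₂ ≠ ±iγ₁²`; hence `Y = X = 0`, then `t =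
0` and `Z = 0`, so `φ` vanishes on `ℂ^2`. This contradicts completeness of the measurement of `A`.
`sq_normSq_add_normSq_le` is the stable form of this elimination and
`IsMeasurement.normSq_star_dotProduct_le` turns high fidelity into small overlaps; averaging over
outcomes gives `exists_forall_outputFidelity_le`. A message from `B` does not help in one round, by
`OneWayLOCC.exists_outputFidelity_eq`.

Protocols. One ebit lets `A` use Bell vectors, whose reduced states on `ℂ^2` have zero Bloch vector
(`exists_isLOCC_one_ebit`). Without an ebit, a first measurement of `B` selects one block of three
basis vectors of `ℂ^9`. The three states then see three different blocks of `φ`, so the single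
number `t` is replaced by three overlaps that can be chosen independently and can cancel the
contribution of `ℂ^2` (`exists_isLOCC_no_ebit`). -/

section General

/-! ### Fidelities of Kraus maps on pure states -/

variable {r x y z a b a' b' : Type}

/-- `1 ⊗ K` applied to a vector of `r ⊗ x`. -/
def applyLocal [Fintype x] (K : Matrix y x ℂ) (Φ : r × x → ℂ) : r × y → ℂ :=
  fun t => (K *ᵥ fun s => Φ (t.1, s)) t.2

theorem applyLocal_applyLocal [Fintype x] [Fintype y] (K : Matrix z y ℂ) (K' : Matrix y x ℂ)
    (Φ : r × x → ℂ) : applyLocal K (applyLocal K' Φ) = applyLocal (K * K') Φ := by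
  funext t
  simp [applyLocal, ← Matrix.mulVec_mulVec]

/-- The squared fidelity of the output of `id ⊗ Λ` on the pure state `Φ` with `Ψ`. -/
def outputFidelity [Fintype r] [Fintype y] (Λ : Matrix x x ℂ → Matrix y y ℂ)
    (Φ : r × x → ℂ) (Ψ : r × y → ℂ) : ℝ :=
  fidelitySq (idTensor r Λ (ketBra Φ)) Ψ

theorem slice_ketBra (Φ : r × x → ℂ) (u v : r) :
    (fun s t => ketBra Φ (u, s) (v, t)) =
      Matrix.vecMulVec (fun s => Φ (u, s)) (star fun s => Φ (v, s)) := by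
  ext s t
  simp [ketBra, Matrix.vecMulVec_apply]

theorem conjugate_vecMulVec [Fintype x] (K : Matrix y x ℂ) (φ χ : x → ℂ) :
    K * Matrix.vecMulVec φ (star χ) * Kᴴ = Matrix.vecMulVec (K *ᵥ φ) (star (K *ᵥ χ)) := by
  rw [Matrix.mul_vecMulVec, Matrix.vecMulVec_mul, Matrix.star_mulVec]

theorem outputFidelity_sum_conjugate {ι : Type} [Fintype ι] [Fintype r] [Fintype x] [Fintype z]
    {Λ : Matrix x x ℂ → Matrix z z ℂ} (Λ' : ι → Matrix y y ℂ → Matrix z z ℂ)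
    (K : ι → Matrix y x ℂ) (h : ∀ ρ, Λ ρ = ∑ m, Λ' m (K m * ρ * (K m)ᴴ))
    (Φ : r × x → ℂ) (Ψ : r × z → ℂ) :
    outputFidelity Λ Φ Ψ = ∑ m, outputFidelity (Λ' m) (applyLocal (K m) Φ) Ψ := by
  have key : idTensor r Λ (ketBra Φ) =
      ∑ m, idTensor r (Λ' m) (ketBra (applyLocal (K m) Φ)) := by
    ext u v
    simp only [idTensor, Matrix.sum_apply, slice_ketBra]
    rw [h, Matrix.sum_apply]
    refine Finset.sum_congr rfl fun m _ => ?_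
    rw [conjugate_vecMulVec]
    rfl
  simp only [outputFidelity, fidelitySq]
  rw [key, Matrix.sum_mulVec, dotProduct_sum, Complex.re_sum]

theorem outputFidelity_conjugate [Fintype r] [Fintype x] [Fintype y]
    (K : Matrix y x ℂ) (Φ : r × x → ℂ) (Ψ : r × y → ℂ) :
    outputFidelity (fun ρ => K * ρ * Kᴴ) Φ Ψ = Complex.normSq (star Ψ ⬝ᵥ applyLocal K Φ) := by
  have key : idTensor r (fun ρ => K * ρ * Kᴴ) (ketBra Φ) = ketBra (applyLocal K Φ) := by
    ext u v
    simp only [idTensor, slice_ketBra]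
    rw [conjugate_vecMulVec]
    rfl
  simp only [outputFidelity, fidelitySq]
  rw [key, ketBra, Matrix.vecMulVec_mulVec, op_smul_eq_smul, dotProduct_smul, smul_eq_mul,
    Matrix.star_dotProduct, ← starRingEnd_apply, ← Complex.normSq_eq_conj_mul_self,
    Complex.ofReal_re]

theorem outputFidelity_local {ι κ : Type} [Fintype ι] [Fintype κ] [Fintype r] [Fintype a]
    [Fintype b] [Fintype a'] [Fintype b'] {Λ : BipartiteMap a b a' b'}
    (M : ι → Matrix a' a ℂ) (N : κ → Matrix b' b ℂ)
    (h : ∀ ρ, Λ ρ = ∑ i, ∑ j, (M i ⊗ₖ N j) * ρ * (M i ⊗ₖ N j)ᴴ)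
    (Φ : r × a × b → ℂ) (Ψ : r × a' × b' → ℂ) :
    outputFidelity Λ Φ Ψ =
      ∑ i, ∑ j, Complex.normSq (star Ψ ⬝ᵥ applyLocal (M i ⊗ₖ N j) Φ) := by
  classical
  rw [outputFidelity_sum_conjugate (ι := ι × κ) (fun _ ρ => ρ) (fun k => M k.1 ⊗ₖ N k.2)
    (fun ρ => by rw [h, Fintype.sum_prod_type]), Fintype.sum_prod_type]
  refine Finset.sum_congr rfl fun i _ => Finset.sum_congr rfl fun j _ => ?_
  have := outputFidelity_conjugate (1 : Matrix (a' × b') (a' × b') ℂ)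
    (applyLocal (M i ⊗ₖ N j) Φ) Ψ
  simp only [Matrix.conjTranspose_one, Matrix.one_mul, Matrix.mul_one,
    applyLocal_applyLocal] at this
  exact this

theorem kronecker_mulVec_apply [Fintype a] [Fintype b] (P : Matrix a' a ℂ) (N : Matrix b' b ℂ)
    (φ : a × b → ℂ) (i : a') (j : b') :
    ((P ⊗ₖ N) *ᵥ φ) (i, j) = (N *ᵥ fun s => (P *ᵥ fun t => φ (t, s)) i) j := by
  simp only [Matrix.mulVec, dotProduct, Fintype.sum_prod_type, Matrix.kroneckerMap_apply,
    Finset.mul_sum]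
  rw [Finset.sum_comm]
  refine Finset.sum_congr rfl fun s _ => Finset.sum_congr rfl fun t _ => ?_
  ring

/-! ### Measurements -/

theorem IsMeasurement.comp {ι : Type} {κ : ι → Type} [Fintype ι] [∀ i, Fintype (κ i)]
    [Fintype x] [DecidableEq x] [Fintype y] [DecidableEq y] [Fintype z]
    {M : ι → Matrix y x ℂ} {M' : ∀ i, κ i → Matrix z y ℂ}
    (hM : IsMeasurement M) (hM' : ∀ i, IsMeasurement (M' i)) :
    IsMeasurement fun k : Σ i, κ i => M' k.1 k.2 * M k.1 := by
  simp only [IsMeasurement] at hM hM' ⊢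
  rw [Fintype.sum_sigma, ← hM]
  refine Finset.sum_congr rfl fun i _ => ?_
  calc ∑ j, (M' i j * M i)ᴴ * (M' i j * M i)
      = (M i)ᴴ * (∑ j, (M' i j)ᴴ * M' i j) * M i := by
        simp only [Matrix.conjTranspose_mul, Matrix.mul_sum, Matrix.sum_mul, Matrix.mul_assoc]
    _ = _ := by rw [hM', Matrix.mul_one]

theorem IsMeasurement.sum_star_dotProduct {ι : Type} [Fintype ι] [Fintype x] [DecidableEq x]
    [Fintype y] {M : ι → Matrix y x ℂ} (hM : IsMeasurement M) (v w : x → ℂ) :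
    ∑ i, star (M i *ᵥ v) ⬝ᵥ (M i *ᵥ w) = star v ⬝ᵥ w := by
  simp only [IsMeasurement] at hM
  conv_rhs => rw [← Matrix.one_mulVec w, ← hM, Matrix.sum_mulVec, dotProduct_sum]
  refine Finset.sum_congr rfl fun i _ => ?_
  rw [Matrix.star_mulVec, ← Matrix.dotProduct_mulVec, Matrix.mulVec_mulVec]

theorem star_dotProduct_self (v : x → ℂ) [Fintype x] :
    star v ⬝ᵥ v = ((∑ i, Complex.normSq (v i) : ℝ) : ℂ) := by
  simp [dotProduct, Complex.normSq_eq_conj_mul_self]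

theorem IsMeasurement.sum_normSq {ι : Type} [Fintype ι] [Fintype x] [DecidableEq x]
    [Fintype y] {M : ι → Matrix y x ℂ} (hM : IsMeasurement M) (v : x → ℂ) :
    ∑ i, ∑ j, Complex.normSq ((M i *ᵥ v) j) = ∑ j, Complex.normSq (v j) := by
  have := hM.sum_star_dotProduct v v
  simp only [star_dotProduct_self] at this
  exact_mod_cast this

theorem IsMeasurement.sum_normSq_row {ι : Type} [Fintype ι] [Fintype x] [DecidableEq x]
    {M : ι → Matrix (Fin 1) x ℂ} (hM : IsMeasurement M) (v : x → ℂ) :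
    ∑ i, Complex.normSq ((M i *ᵥ v) 0) = ∑ j, Complex.normSq (v j) := by
  simpa using hM.sum_normSq v

/-- The measurement in the computational basis. -/
theorem isMeasurement_single [Fintype x] [DecidableEq x] :
    IsMeasurement fun i : x => Matrix.replicateRow (Fin 1) (Pi.single i (1 : ℂ)) := by
  ext s t
  simp only [Matrix.sum_apply, Matrix.mul_apply, Matrix.conjTranspose_apply, Fin.sum_univ_one,
    Matrix.one_apply, Matrix.replicateRow_apply, Pi.single_apply]
  simp

theorem star_dotProduct_applyLocal_row [Fintype r] [Fintype a] [Fintype b] [Fintype b']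
    (P : Matrix (Fin 1) a ℂ) (N : Matrix b' b ℂ) (Φ : r × a × b → ℂ) (Ψ : r × Fin 1 × b' → ℂ) :
    star Ψ ⬝ᵥ applyLocal (P ⊗ₖ N) Φ =
      (P *ᵥ fun t => ∑ s, star (fun j => Ψ (s, 0, j)) ⬝ᵥ (N *ᵥ fun k => Φ (s, t, k))) 0 := by
  simp only [dotProduct, Fintype.sum_prod_type, applyLocal, Fin.sum_univ_one,
    kronecker_mulVec_apply, Pi.star_apply]
  simp only [Matrix.mulVec, dotProduct, Finset.mul_sum]
  rw [Finset.sum_comm (s := (Finset.univ : Finset a))]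
  refine Finset.sum_congr rfl fun s _ => ?_
  rw [Finset.sum_comm (s := (Finset.univ : Finset a))]
  refine Finset.sum_congr rfl fun j _ => ?_
  rw [Finset.sum_comm (s := (Finset.univ : Finset a))]
  refine Finset.sum_congr rfl fun k _ => Finset.sum_congr rfl fun t _ => ?_
  ring

/-! ### Reduction of one-way protocols to rank-one measurements of `A` -/

/-- If the output of `A` is trivial, every one-way protocol has the fidelities of a protocol in
which `A` performs a measurement with operators of rank one, announces the outcome, and `B`
then performs a measurement. -/
theorem OneWayLOCC.exists_outputFidelity_eq [Fintype a] [DecidableEq a] [Fintype b]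
    [DecidableEq b] [Fintype b'] {Λ : BipartiteMap a b (Fin 1) b'}
    (hΛ : OneWayLOCC a b (Fin 1) b' Λ) :
    ∃ (κ : Type) (_ : Fintype κ) (ι : κ → Type) (_ : ∀ k, Fintype (ι k))
      (P : κ → Matrix (Fin 1) a ℂ) (N : ∀ k, ι k → Matrix b' b ℂ),
      IsMeasurement P ∧ (∀ k, IsMeasurement (N k)) ∧
      ∀ {r : Type} [Fintype r] (Φ : r × a × b → ℂ) (Ψ : r × Fin 1 × b' → ℂ),
        outputFidelity Λ Φ Ψ =
          ∑ k, ∑ j, Complex.normSq (star Ψ ⬝ᵥ applyLocal (P k ⊗ₖ N k j) Φ) := by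
  obtain ⟨v, n, hv⟩ := hΛ
  cases v with
  | A =>
    obtain ⟨c, M, Λ', hM, hΛ', hΛ⟩ := hv
    choose p q M' N hM' hN h using hΛ'
    -- The final measurement of `A` is absorbed into the announced one; the measurement of `B`
    -- ignores the extra part of the outcome.
    refine ⟨Σ m, Fin (p m), inferInstance, fun k => Fin (q k.1), inferInstance,
      fun k => M' k.1 k.2 * M k.1, fun k => N k.1, hM.comp hM', fun k => hN k.1, ?_⟩
    intro r _ Φ Ψ
    rw [outputFidelity_sum_conjugate Λ' _ hΛ, Fintype.sum_sigma]
    refine Finset.sum_congr rfl fun m _ => ?_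
    rw [outputFidelity_local _ _ (h m)]
    simp only [applyLocal_applyLocal, ← Matrix.mul_kronecker_mul, Matrix.mul_one]
  | B =>
    obtain ⟨c, M, Λ', hM, hΛ', hΛ⟩ := hv
    choose p q M' N hM' hN h using hΛ'
    -- Once an operator of `B` is fixed, the fidelity is the sum of squared amplitudes of one vector
    -- of `A`, the same for every complete rank-one measurement. So `A` may ignore the message and
    -- measure in the computational basis.
    refine ⟨a, inferInstance, fun _ => Σ m, Fin (q m), inferInstance,
      fun i => Matrix.replicateRow (Fin 1) (Pi.single i 1), fun _ k => N k.1 k.2 * M k.1,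
      isMeasurement_single, fun _ => hM.comp hN, ?_⟩
    intro r _ Φ Ψ
    refine Eq.trans ?_ (Finset.sum_comm (s := (Finset.univ : Finset (Σ m, Fin (q m))))
      (t := (Finset.univ : Finset a)))
    rw [outputFidelity_sum_conjugate Λ' _ hΛ, Fintype.sum_sigma]
    refine Finset.sum_congr rfl fun m _ => ?_
    rw [outputFidelity_local _ _ (h m), Finset.sum_comm]
    refine Finset.sum_congr rfl fun j _ => ?_
    simp only [applyLocal_applyLocal, ← Matrix.mul_kronecker_mul, Matrix.mul_one,
      star_dotProduct_applyLocal_row]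
    rw [(hM' m).sum_normSq_row, isMeasurement_single.sum_normSq_row]

end General

/-! ### High fidelity forces nearly orthogonal vectors -/

section

/-- The hypotheses give `∑ ‖W i - F i‖² = S - f` with `S = ∑ ‖W i‖²`. Thus `W` is close to an
orthogonal family when `f` is close to `S`, and Cauchy–Schwarz transfers the orthogonality. -/
theorem norm_inner_sq_le_of_orthogonal {H ι : Type*} [NormedAddCommGroup H]
    [InnerProductSpace ℂ H] [Fintype ι] (W F : ι → H) {f : ℝ}
    (hF : ∀ i j, i ≠ j → inner ℂ (F i) (F j) = 0) (hFf : ∑ i, ‖F i‖ ^ 2 = f)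
    (hFW : ∑ i, inner ℂ (W i) (F i) = (f : ℂ)) :
    f ≤ ∑ i, ‖W i‖ ^ 2 ∧ ∀ i j, i ≠ j →
      ‖inner ℂ (W i) (W j)‖ ^ 2 ≤ 4 * (∑ i, ‖W i‖ ^ 2) * (∑ i, ‖W i‖ ^ 2 - f) := by
  set S := ∑ i, ‖W i‖ ^ 2 with hS
  have hR : ∑ i, ‖W i - F i‖ ^ 2 = S - f := by
    have h1 : ∑ i, RCLike.re (inner ℂ (W i) (F i)) = f := by
      rw [← map_sum, hFW]; simp
    simp only [@norm_sub_sq ℂ, Finset.sum_add_distrib, Finset.sum_sub_distrib,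
      ← Finset.mul_sum, h1, hFf, ← hS]
    ring
  have hR0 : 0 ≤ S - f := hR ▸ Finset.sum_nonneg fun i _ => sq_nonneg _
  have hf0 : 0 ≤ f := hFf ▸ Finset.sum_nonneg fun i _ => sq_nonneg _
  have le_sqrt : ∀ (G : ι → H) (t : ℝ), ∑ i, ‖G i‖ ^ 2 = t → ∀ i, ‖G i‖ ≤ √t := by
    intro G t ht i
    refine Real.le_sqrt_of_sq_le ?_
    rw [← ht]
    exact Finset.single_le_sum (f := fun i => ‖G i‖ ^ 2) (fun _ _ => sq_nonneg _)
      (Finset.mem_univ i)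
  refine ⟨by linarith, fun i j hij => ?_⟩
  have hdecomp : inner ℂ (W i) (W j) =
      inner ℂ (W i - F i) (W j) + inner ℂ (F i) (W j - F j) := by
    rw [inner_sub_left, inner_sub_right, hF i j hij]
    ring
  have hfS : √f ≤ √S := Real.sqrt_le_sqrt (by linarith)
  have hbound : ‖inner ℂ (W i) (W j)‖ ≤ 2 * (√S * √(S - f)) := by
    rw [hdecomp]
    calc _ ≤ ‖W i - F i‖ * ‖W j‖ + ‖F i‖ * ‖W j - F j‖ :=
          (norm_add_le _ _).trans (add_le_add (norm_inner_le_norm _ _) (norm_inner_le_norm _ _))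
      _ ≤ √(S - f) * √S + √S * √(S - f) := by
          gcongr
          · exact le_sqrt (fun i => W i - F i) _ hR i
          · exact le_sqrt W _ hS.symm j
          · exact (le_sqrt F _ hFf i).trans hfS
          · exact le_sqrt (fun i => W i - F i) _ hR j
      _ = _ := by ring
  calc _ ≤ (2 * (√S * √(S - f))) ^ 2 := by gcongr
    _ = 4 * √S ^ 2 * √(S - f) ^ 2 := by ring
    _ = _ := by rw [Real.sq_sqrt (by linarith), Real.sq_sqrt hR0]

section

variable {r x y ι : Type} [Fintype r] [Fintype x] [DecidableEq x] [Fintype y] [Fintype ι]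

/-- A measurement that approximately maps the vectors `W s` to the orthogonal vectors `E s`
can only exist if the vectors `W s` are approximately orthogonal. -/
theorem IsMeasurement.normSq_star_dotProduct_le {N : ι → Matrix y x ℂ} (hN : IsMeasurement N)
    (W : r → x → ℂ) (E : r → y → ℂ) (hE : ∀ s s', s ≠ s' → star (E s) ⬝ᵥ E s' = 0)
    (hE1 : ∑ s, star (E s) ⬝ᵥ E s = 1) {S f : ℝ} (hS : ∑ s, star (W s) ⬝ᵥ W s = (S : ℂ))
    (hf : ∑ j, Complex.normSq (∑ s, star (E s) ⬝ᵥ (N j *ᵥ W s)) = f) :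
    f ≤ S ∧ ∀ s s', s ≠ s' → Complex.normSq (star (W s) ⬝ᵥ W s') ≤ 4 * S * (S - f) := by
  set V : ι → ℂ := fun j => ∑ s, star (E s) ⬝ᵥ (N j *ᵥ W s) with hV
  have hfV : (f : ℂ) = ∑ j, star (V j) * V j := by
    rw [← hf, Complex.ofReal_sum]
    exact Finset.sum_congr rfl fun j _ => Complex.normSq_eq_conj_mul_self
  -- Stacking all outcomes makes the measurement an isometry, so `W'` has the Gram matrix of `W`.
  -- The comparison vectors `F'` weight the targets by the amplitudes `V j`, so that both `∑ ‖F'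
  -- s‖²` and the overlap with `W'` equal `f`.
  let W' : r → EuclideanSpace ℂ (ι × y) := fun s => WithLp.toLp 2 fun t => (N t.1 *ᵥ W s) t.2
  let F' : r → EuclideanSpace ℂ (ι × y) := fun s => WithLp.toLp 2 fun t => V t.1 * E s t.2
  have hWW : ∀ s s', inner ℂ (W' s) (W' s') = star (W s) ⬝ᵥ W s' := by
    intro s s'
    rw [← hN.sum_star_dotProduct, EuclideanSpace.inner_eq_star_dotProduct, dotProduct_comm]
    simp only [W', dotProduct, Fintype.sum_prod_type, Pi.star_apply]
  have hFF : ∀ s s', inner ℂ (F' s) (F' s') = (f : ℂ) * (star (E s) ⬝ᵥ E s') := by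
    intro s s'
    rw [EuclideanSpace.inner_eq_star_dotProduct, dotProduct_comm, hfV]
    simp only [F', dotProduct, Fintype.sum_prod_type, Pi.star_apply,
      Finset.sum_mul, Finset.mul_sum, star_mul']
    rw [Finset.sum_comm]
    refine Finset.sum_congr rfl fun s _ => Finset.sum_congr rfl fun t _ => ?_
    ring
  have hWF : ∑ s, inner ℂ (W' s) (F' s) = (f : ℂ) := by
    have h1 : ∀ s, inner ℂ (W' s) (F' s) = ∑ j, V j * star (star (E s) ⬝ᵥ (N j *ᵥ W s)) := by
      intro s
      rw [EuclideanSpace.inner_eq_star_dotProduct]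
      simp only [F', W', dotProduct, Fintype.sum_prod_type, Pi.star_apply, Finset.mul_sum,
        star_sum, star_mul', star_star]
      refine Finset.sum_congr rfl fun s _ => Finset.sum_congr rfl fun t _ => ?_
      ring
    simp only [h1]
    rw [Finset.sum_comm, hfV]
    refine Finset.sum_congr rfl fun j _ => ?_
    rw [← Finset.mul_sum, ← star_sum, mul_comm]
  have hnorm : ∀ v : EuclideanSpace ℂ (ι × y), ((‖v‖ ^ 2 : ℝ) : ℂ) = inner ℂ v v := by
    intro v
    rw [inner_self_eq_norm_sq_to_K]
    simp
  have hSW : ∑ s, ‖W' s‖ ^ 2 = S := by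
    have : ((∑ s, ‖W' s‖ ^ 2 : ℝ) : ℂ) = S := by
      rw [Complex.ofReal_sum, ← hS]
      simp only [hnorm, hWW]
    exact_mod_cast this
  have hSF : ∑ s, ‖F' s‖ ^ 2 = f := by
    have : ((∑ s, ‖F' s‖ ^ 2 : ℝ) : ℂ) = f := by
      rw [Complex.ofReal_sum]
      simp only [hnorm, hFF, ← Finset.mul_sum, hE1, mul_one]
    exact_mod_cast this
  have := norm_inner_sq_le_of_orthogonal W' F' (f := f)
    (fun i j hij => by rw [hFF, hE i j hij, mul_zero]) hSF hWF
  rw [hSW] at this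
  refine ⟨this.1, fun s s' hs => ?_⟩
  rw [Complex.normSq_eq_norm_sq, ← hWW]
  exact this.2 s s' hs

end

end

/-! ### Contraction of the states with a row vector of `A` -/

section

theorem star_dotProduct_applyLocal_kronecker {r a b b' : Type} [Fintype r] [Fintype a] [Fintype b]
    [Fintype b'] (P : Matrix (Fin 1) a ℂ) (N : Matrix b' b ℂ) (Φ : r × a × b → ℂ)
    (Ψ : r × Fin 1 × b' → ℂ) :
    star Ψ ⬝ᵥ applyLocal (P ⊗ₖ N) Φ =
      ∑ s, star (fun j => Ψ (s, 0, j)) ⬝ᵥ (N *ᵥ fun k => (P *ᵥ fun t => Φ (s, t, k)) 0) := by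
  simp only [dotProduct, Fintype.sum_prod_type, applyLocal, Fin.sum_univ_one,
    kronecker_mulVec_apply, Pi.star_apply]

theorem IsMeasurement.sum_normSq_entry {κ x : Type} [Fintype κ] [Fintype x] [DecidableEq x]
    {P : κ → Matrix (Fin 1) x ℂ} (hP : IsMeasurement P) (i : x) :
    ∑ k, Complex.normSq (P k 0 i) = 1 := by
  have := congrFun (congrFun hP i) i
  simp only [Matrix.sum_apply, Matrix.mul_apply, Matrix.conjTranspose_apply, Fin.sum_univ_one,
    Matrix.one_apply_eq] at this
  have h2 : ((∑ k, Complex.normSq (P k 0 i) : ℝ) : ℂ) = 1 := by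
    rw [← this, Complex.ofReal_sum]
    exact Finset.sum_congr rfl fun k _ => Complex.normSq_eq_conj_mul_self
  exact_mod_cast h2

/-! ### The states as images of the maximally entangled state -/

theorem pauliX_pow_apply (k : ℕ) [NeZero k] (m : ℕ) (i j : Fin k) :
    (pauliX k ^ m) i j = if i = j + m • (1 : Fin k) then 1 else 0 := by
  induction m generalizing i j with
  | zero => simp [Matrix.one_apply]
  | succ m ih =>
    rw [pow_succ, Matrix.mul_apply]
    simp only [ih, pauliX, mul_ite, mul_one, mul_zero, Finset.sum_ite_eq', Finset.mem_univ,
      if_true, add_smul, one_smul, add_assoc, add_comm (1 : Fin k)]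

theorem onMaxEntangled_apply {k : ℕ} (M : Matrix (Fin k) (Fin k) ℂ) (i j : Fin k) :
    onMaxEntangled M (i, j) = M i j * ((√(k : ℝ) : ℝ) : ℂ)⁻¹ := by
  rw [onMaxEntangled, kronecker_mulVec_apply, Matrix.one_mulVec]
  simp [Matrix.mulVec, dotProduct, maxEntangled]

theorem pauliZ_two : pauliZ 2 = Matrix.diagonal fun l : Fin 2 => (-1 : ℂ) ^ (l : ℕ) := by
  rw [pauliZ]
  congr 1
  funext l
  fin_cases l
  · simp
  · simp only [Nat.cast_one, Nat.cast_ofNat, pow_one]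
    rw [← Complex.exp_pi_mul_I]
    congr 1
    ring

theorem sqrt_two_div_mul_inv :
    ((√(2 / 11 : ℝ) : ℝ) : ℂ) * ((√((2 : ℕ) : ℝ) : ℝ) : ℂ)⁻¹ = ((√11 : ℝ) : ℂ)⁻¹ := by
  have : (√(2 : ℝ) : ℂ) ≠ 0 := by norm_num
  rw [Real.sqrt_div (by norm_num)]
  push_cast
  field_simp

theorem sqrt_nine_div_mul_inv :
    ((√(9 / 11 : ℝ) : ℝ) : ℂ) * ((√((9 : ℕ) : ℝ) : ℝ) : ℂ)⁻¹ = ((√11 : ℝ) : ℂ)⁻¹ := by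
  have : (√(9 : ℝ) : ℂ) ≠ 0 := by norm_num
  rw [Real.sqrt_div (by norm_num)]
  push_cast
  field_simp

/-- The unnormalized vector of `B` that is left from `psiAB γ₁ γ₂ l` when `A` applies the
row vector `φ`. -/
def rowImage (γ₁ γ₂ : ℂ) (φ : C11 → ℂ) : Fin 3 → C11 → ℂ :=
  ![φ,
    Sum.elim (fun b => γ₁ * φ (Sum.inl (b + 1))) (fun b => φ (Sum.inr (b + 3))),
    Sum.elim (fun b => γ₂ * ((-1) ^ (b : ℕ) * φ (Sum.inl b))) (fun b => φ (Sum.inr (b + 6)))]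

variable (γ₁ γ₂ : ℂ)

theorem sum_mul_psiAB (φ : C11 → ℂ) (l : Fin 3) (b : C11) :
    ∑ a, φ a * psiAB γ₁ γ₂ l (a, b) = ((√11 : ℝ) : ℂ)⁻¹ * rowImage γ₁ γ₂ φ l b := by
  have h2 := sqrt_two_div_mul_inv
  have h9 := sqrt_nine_div_mul_inv
  have h3 : 3 • (1 : Fin 9) = 3 := rfl
  have h6 : 6 • (1 : Fin 9) = 6 := rfl
  fin_cases l <;> rcases b with b | b
  · simp [psiAB, weightedSum, rowImage, maxEntangled, ← h2]
    ring
  · simp [psiAB, weightedSum, rowImage, maxEntangled, ← h9]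
    ring
  · simp [psiAB, weightedSum, rowImage, onMaxEntangled_apply, pauliX, ← h2]
    ring
  · simp [psiAB, weightedSum, rowImage, onMaxEntangled_apply, pauliX_pow_apply, h3, ← h9]
    ring
  · simp [psiAB, weightedSum, rowImage, onMaxEntangled_apply, pauliZ_two, Matrix.diagonal_apply,
      ← h2]
    ring
  · simp [psiAB, weightedSum, rowImage, onMaxEntangled_apply, pauliX_pow_apply, h6, ← h9]
    ring

theorem psiAB_apply (l : Fin 3) (a b : C11) :
    psiAB γ₁ γ₂ l (a, b) = ((√11 : ℝ) : ℂ)⁻¹ * rowImage γ₁ γ₂ (Pi.single a 1) l b := by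
  rw [← sum_mul_psiAB]
  simp [Pi.single_apply]

/-- The bracket is the Bloch coordinate `X`, and the sum is the lag-3 autocorrelation `t`. -/
theorem star_rowImage_zero_one (φ : C11 → ℂ) :
    star (rowImage γ₁ γ₂ φ 0) ⬝ᵥ rowImage γ₁ γ₂ φ 1 =
      γ₁ * (conj (φ (Sum.inl 0)) * φ (Sum.inl 1) + conj (φ (Sum.inl 1)) * φ (Sum.inl 0)) +
        ∑ b, conj (φ (Sum.inr b)) * φ (Sum.inr (b + 3)) := by
  simp [rowImage, dotProduct]
  ring

/-- Lag 6 is lag -3 modulo 9, which conjugates the autocorrelation. -/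
theorem star_rowImage_zero_two (φ : C11 → ℂ) :
    star (rowImage γ₁ γ₂ φ 0) ⬝ᵥ rowImage γ₁ γ₂ φ 2 =
      γ₂ * (conj (φ (Sum.inl 0)) * φ (Sum.inl 0) - conj (φ (Sum.inl 1)) * φ (Sum.inl 1)) +
        conj (∑ b, conj (φ (Sum.inr b)) * φ (Sum.inr (b + 3))) := by
  have : ∑ b : Fin 9, conj (φ (Sum.inr b)) * φ (Sum.inr (b + 6)) =
      ∑ b : Fin 9, φ (Sum.inr b) * conj (φ (Sum.inr (b + 3))) := by
    refine Fintype.sum_equiv (Equiv.addRight 6) _ _ fun b => ?_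
    have hb : b + 6 + 3 = b := by rw [add_assoc]; exact add_zero b
    simp [hb, mul_comm]
  simp [rowImage, dotProduct, this]
  ring

/-- The relative shift is again 3, so the same `t` reappears. This coincidence ties the three
overlaps together. -/
theorem star_rowImage_one_two (φ : C11 → ℂ) :
    star (rowImage γ₁ γ₂ φ 1) ⬝ᵥ rowImage γ₁ γ₂ φ 2 =
      conj γ₁ * γ₂ * (conj (φ (Sum.inl 1)) * φ (Sum.inl 0) -
        conj (φ (Sum.inl 0)) * φ (Sum.inl 1)) +
        ∑ b, conj (φ (Sum.inr b)) * φ (Sum.inr (b + 3)) := by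
  have : ∑ b : Fin 9, conj (φ (Sum.inr (b + 3))) * φ (Sum.inr (b + 6)) =
      ∑ b : Fin 9, conj (φ (Sum.inr b)) * φ (Sum.inr (b + 3)) := by
    refine Fintype.sum_equiv (Equiv.addRight 3) _ _ fun b => ?_
    have hb : b + 3 + 3 = b + 6 := by rw [add_assoc]; rfl
    simp [hb]
  simp [rowImage, dotProduct, this]
  ring

theorem star_rowImage_self (h₁ : ‖γ₁‖ = 1) (h₂ : ‖γ₂‖ = 1) (φ : C11 → ℂ) (l : Fin 3) :
    star (rowImage γ₁ γ₂ φ l) ⬝ᵥ rowImage γ₁ γ₂ φ l = star φ ⬝ᵥ φ := by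
  have h₁' : conj γ₁ * γ₁ = 1 := by
    rw [← Complex.normSq_eq_conj_mul_self, Complex.normSq_eq_norm_sq, h₁]; simp
  have h₂' : conj γ₂ * γ₂ = 1 := by
    rw [← Complex.normSq_eq_conj_mul_self, Complex.normSq_eq_norm_sq, h₂]; simp
  fin_cases l
  · simp [rowImage]
  · have : ∑ b : Fin 9, conj (φ (Sum.inr (b + 3))) * φ (Sum.inr (b + 3)) =
        ∑ b : Fin 9, conj (φ (Sum.inr b)) * φ (Sum.inr b) :=
      Fintype.sum_equiv (Equiv.addRight 3) _ _ fun b => rfl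
    simp [rowImage, dotProduct, this]
    linear_combination (conj (φ (Sum.inl 0)) * φ (Sum.inl 0) +
      conj (φ (Sum.inl 1)) * φ (Sum.inl 1)) * h₁'
  · have : ∑ b : Fin 9, conj (φ (Sum.inr (b + 6))) * φ (Sum.inr (b + 6)) =
        ∑ b : Fin 9, conj (φ (Sum.inr b)) * φ (Sum.inr b) :=
      Fintype.sum_equiv (Equiv.addRight 6) _ _ fun b => rfl
    simp [rowImage, dotProduct, this]
    linear_combination (conj (φ (Sum.inl 0)) * φ (Sum.inl 0) +
      conj (φ (Sum.inl 1)) * φ (Sum.inl 1)) * h₂'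

end

/-! ### The fidelity bound for one-way protocols without entanglement -/

section

variable {γ₁ γ₂ : ℂ}

/-- A real number of modulus one is `±1`, and these two values of the phase are the excluded cases.
-/
theorem im_phase_ne_zero (h₁ : ‖γ₁‖ = 1) (h₂ : ‖γ₂‖ = 1) (hpos : γ₂ ≠ Complex.I * γ₁ ^ 2)
    (hneg : γ₂ ≠ -(Complex.I * γ₁ ^ 2)) : (Complex.I * conj γ₁ ^ 2 * γ₂).im ≠ 0 := by
  intro h
  set β := Complex.I * conj γ₁ ^ 2 * γ₂ with hβ
  have h₁' : γ₁ * conj γ₁ = 1 := by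
    rw [Complex.mul_conj, Complex.normSq_eq_norm_sq, h₁]; simp
  have hβ1 : ‖β‖ = 1 := by simp [hβ, h₁, h₂]
  have hre : β = (β.re : ℂ) := Complex.ext rfl (by simp [h])
  have hγ : γ₂ = -(Complex.I * γ₁ ^ 2) * β := by
    rw [hβ]
    linear_combination γ₂ * (-(γ₁ * conj γ₁) - 1) * h₁' + γ₁ ^ 2 * conj γ₁ ^ 2 * γ₂ *
      Complex.I_sq
  rw [hre, Complex.norm_real, Real.norm_eq_abs] at hβ1
  rcases (abs_eq (by norm_num)).1 hβ1 with h1 | h1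
  · rw [hre, h1] at hγ
    exact hneg (by simpa using hγ)
  · rw [hre, h1] at hγ
    exact hpos (by simpa using hγ)

/-- The unknown `t` is eliminated from pairs of overlaps, which bounds in turn `Y`, `X` and `Z`; the
left side is the squared length of the Bloch vector. -/
theorem sq_normSq_add_normSq_le (h₁ : ‖γ₁‖ = 1) (h₂ : ‖γ₂‖ = 1) {s : ℝ} (hs : s ≠ 0)
    (hsβ : (Complex.I * conj γ₁ ^ 2 * γ₂).im = s) {B : ℝ} (u v t : ℂ)
    (h01 : Complex.normSq (γ₁ * (conj u * v + conj v * u) + t) ≤ B)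
    (h02 : Complex.normSq (γ₂ * (conj u * u - conj v * v) + conj t) ≤ B)
    (h12 : Complex.normSq (conj γ₁ * γ₂ * (conj v * u - conj u * v) + t) ≤ B) :
    (Complex.normSq u + Complex.normSq v) ^ 2 ≤ 56 / s ^ 2 * B := by
  have hB : 0 ≤ B := (Complex.normSq_nonneg _).trans h01
  have h₁' : γ₁ * conj γ₁ = 1 := by
    rw [Complex.mul_conj, Complex.normSq_eq_norm_sq, h₁]; simp
  simp only [Complex.normSq_eq_norm_sq] at h01 h02 h12
  replace h01 := Real.le_sqrt_of_sq_le h01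
  replace h02 := Real.le_sqrt_of_sq_le h02
  replace h12 := Real.le_sqrt_of_sq_le h12
  set η := √B with hη
  have hη0 : 0 ≤ η := Real.sqrt_nonneg _
  have hηB : η ^ 2 = B := Real.sq_sqrt hB
  set β := Complex.I * conj γ₁ ^ 2 * γ₂ with hβ
  have hβ1 : ‖β‖ = 1 := by simp [hβ, h₁, h₂]
  have hs1 : |s| ≤ 1 := by rw [← hsβ, ← hβ1]; exact Complex.abs_im_le_norm β
  have hs0 : 0 < |s| := abs_pos.2 hs
  set X : ℝ := 2 * (conj u * v).re with hX
  set Y : ℝ := 2 * (conj u * v).im with hY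
  set Z : ℝ := Complex.normSq u - Complex.normSq v with hZ
  have eX : conj u * v + conj v * u = (X : ℂ) := by
    apply Complex.ext
    · simp [hX]; ring
    · simp
      ring
  have eY : conj v * u - conj u * v = -(Complex.I * (Y : ℂ)) := by
    apply Complex.ext
    · simp [mul_comm]
    · simp [hY]; ring
  have eZ : conj u * u - conj v * v = (Z : ℂ) := by
    simp [hZ, Complex.normSq_eq_conj_mul_self]
  rw [eX] at h01
  rw [eZ] at h02
  rw [eY] at h12
  -- The difference of the overlaps 01 and 12 is free of `t`; its imaginary part, after
  -- multiplication by `conj γ₁`, isolates `Y`.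
  have k1 : ‖(X : ℂ) + β * Y‖ ≤ 2 * η := by
    have : (X : ℂ) + β * Y = conj γ₁ * ((γ₁ * X + t) -
        (conj γ₁ * γ₂ * -(Complex.I * (Y : ℂ)) + t)) := by
      rw [hβ]
      linear_combination -(X : ℂ) * h₁'
    rw [this, norm_mul, RCLike.norm_conj, h₁, one_mul]
    exact (norm_sub_le _ _).trans (by linarith)
  have k2 : |Y| * |s| ≤ 2 * η := by
    have := (Complex.abs_im_le_norm ((X : ℂ) + β * Y)).trans k1
    simpa [hsβ, abs_mul, mul_comm] using this
  have k3 : |X| ≤ 2 * η + |Y| := by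
    have e : (X : ℂ) = ((X : ℂ) + β * Y) - β * Y := by ring
    have := norm_sub_le ((X : ℂ) + β * Y) (β * Y)
    rw [← e, norm_mul, hβ1, one_mul, Complex.norm_real, Complex.norm_real, Real.norm_eq_abs,
      Real.norm_eq_abs] at this
    linarith
  have k4 : |Z| ≤ 2 * η + |X| := by
    have e : γ₂ * (Z : ℂ) = (γ₂ * Z + conj t) - conj (γ₁ * X + t) + conj γ₁ * X := by
      simp
    have hn : ‖γ₂ * (Z : ℂ)‖ ≤ η + η + |X| := by
      rw [e]
      refine (norm_add_le _ _).trans (add_le_add ((norm_sub_le _ _).trans (add_le_add h02 ?_)) ?_)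
      · rw [RCLike.norm_conj]; exact h01
      · rw [norm_mul, RCLike.norm_conj, h₁, one_mul, Complex.norm_real, Real.norm_eq_abs]
    rw [norm_mul, h₂, one_mul, Complex.norm_real, Real.norm_eq_abs] at hn
    linarith
  have hY' : |Y| ≤ 2 * η / |s| := (le_div_iff₀ hs0).2 k2
  have hηs : 2 * η ≤ 2 * η / |s| := by
    rw [le_div_iff₀ hs0]
    nlinarith
  have hX' : |X| ≤ 2 * (2 * η / |s|) := by linarith
  have hZ' : |Z| ≤ 3 * (2 * η / |s|) := by linarith
  have e : (Complex.normSq u + Complex.normSq v) ^ 2 = X ^ 2 + Y ^ 2 + Z ^ 2 := by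
    simp only [hX, hY, hZ, Complex.normSq_apply, Complex.mul_re, Complex.mul_im, Complex.conj_re,
      Complex.conj_im]
    ring
  have e2 : (2 * η / |s|) ^ 2 = 4 * B / s ^ 2 := by
    rw [div_pow, sq_abs, mul_pow, hηB]; norm_num
  rw [e, ← sq_abs X, ← sq_abs Y, ← sq_abs Z]
  -- The bounds have ratios 2, 1, 3, whence `14 = 4 + 1 + 9` and the constant `56 = 4 * 14`.
  calc |X| ^ 2 + |Y| ^ 2 + |Z| ^ 2
      ≤ (2 * (2 * η / |s|)) ^ 2 + (2 * η / |s|) ^ 2 + (3 * (2 * η / |s|)) ^ 2 := by gcongr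
    _ = 14 * (2 * η / |s|) ^ 2 := by ring
    _ = _ := by rw [e2]; ring

variable (γ₁ γ₂) in
theorem initialState_row (K : ℕ) (P : Matrix (Fin 1) (C11 × Fin K) ℂ) (l : Fin 3)
    (b : C11 × Fin K) :
    (P *ᵥ fun t => initialState (psiRAB γ₁ γ₂) K (l, t, b)) 0 =
      ((√33 : ℝ) : ℂ)⁻¹ * ((√(K : ℝ) : ℝ) : ℂ)⁻¹ *
        rowImage γ₁ γ₂ (fun a => P 0 (a, b.2)) l b.1 := by
  have h33 : ((√33 : ℝ) : ℂ)⁻¹ = ((√3 : ℝ) : ℂ)⁻¹ * ((√11 : ℝ) : ℂ)⁻¹ := by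
    rw [← mul_inv, ← Complex.ofReal_mul, ← Real.sqrt_mul (by norm_num)]
    norm_num
  have := sum_mul_psiAB γ₁ γ₂ (fun a => P 0 (a, b.2)) l b.1
  rw [h33]
  calc _ = ((√3 : ℝ) : ℂ)⁻¹ * ((√(K : ℝ) : ℝ) : ℂ)⁻¹ *
        ∑ a, P 0 (a, b.2) * psiAB γ₁ γ₂ l (a, b.1) := by
        rw [Matrix.mulVec, dotProduct, Fintype.sum_prod_type, Finset.mul_sum]
        refine Finset.sum_congr rfl fun a _ => ?_
        simp only [initialState, psiRAB, maxEntangled, mul_ite, mul_zero, Finset.sum_ite_eq',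
          Finset.mem_univ, if_true]
        ring
    _ = _ := by rw [this]; ring

theorem star_targetState_dotProduct (l l' : Fin 3) :
    star (fun j => targetState (psiRAB γ₁ γ₂) 1 (l, 0, j)) ⬝ᵥ
      (fun j => targetState (psiRAB γ₁ γ₂) 1 (l', 0, j)) =
      (3 : ℂ)⁻¹ * (star (psiAB γ₁ γ₂ l) ⬝ᵥ psiAB γ₁ γ₂ l') := by
  have h3 : ((√3 : ℝ) : ℂ)⁻¹ * ((√3 : ℝ) : ℂ)⁻¹ = (3 : ℂ)⁻¹ := by
    rw [← mul_inv, ← Complex.ofReal_mul, Real.mul_self_sqrt (by norm_num)]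
    norm_num
  have ht : ∀ (l : Fin 3) (y : C11 × C11), targetState (psiRAB γ₁ γ₂) 1 (l, 0, y, 0) =
      ((√3 : ℝ) : ℂ)⁻¹ * psiAB γ₁ γ₂ l y := by
    intro l y
    simp [targetState, psiRAB, maxEntangled]
  simp only [dotProduct, Fintype.sum_prod_type _ (α₁ := C11 × C11), Fin.sum_univ_one,
    Pi.star_apply, ht, Finset.mul_sum, star_mul', ← h3]
  refine Finset.sum_congr rfl fun y _ => ?_
  simp only [Complex.star_def, map_inv₀, Complex.conj_ofReal]
  ring

/-- Summing over basis rows of `A`, the terms `X`, `Y` and `t` vanish for each row, and `Z` cancels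
between the two rows of `ℂ^2`. -/
theorem star_psiAB_dotProduct (h₁ : ‖γ₁‖ = 1) (h₂ : ‖γ₂‖ = 1) (l l' : Fin 3) :
    star (psiAB γ₁ γ₂ l) ⬝ᵥ psiAB γ₁ γ₂ l' = if l = l' then 1 else 0 := by
  have h11 : ((√11 : ℝ) : ℂ)⁻¹ * ((√11 : ℝ) : ℂ)⁻¹ = (11 : ℂ)⁻¹ := by
    rw [← mul_inv, ← Complex.ofReal_mul, Real.mul_self_sqrt (by norm_num)]
    norm_num
  have hsum : ∀ l l', star (psiAB γ₁ γ₂ l) ⬝ᵥ psiAB γ₁ γ₂ l' = (11 : ℂ)⁻¹ *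
      ∑ a, star (rowImage γ₁ γ₂ (Pi.single a 1) l) ⬝ᵥ rowImage γ₁ γ₂ (Pi.single a 1) l' := by
    intro l l'
    simp only [dotProduct, Fintype.sum_prod_type _ (α₁ := C11), Pi.star_apply, psiAB_apply,
      Finset.mul_sum, star_mul', ← h11]
    refine Finset.sum_congr rfl fun a _ => Finset.sum_congr rfl fun b _ => ?_
    simp only [Complex.star_def, map_inv₀, Complex.conj_ofReal]
    ring
  have hzero : ∀ a : C11, ∑ b : Fin 9, conj ((Pi.single a 1 : C11 → ℂ) (Sum.inr b)) *
      (Pi.single a 1 : C11 → ℂ) (Sum.inr (b + 3)) = 0 := by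
    have hne : ∀ b : Fin 9, b + 3 ≠ b := by decide
    refine fun a => Finset.sum_eq_zero fun b _ => ?_
    by_cases h : Sum.inr b = a
    · subst h
      simp [hne]
    · simp [Pi.single_apply, h]
  have key : ∀ l l', l < l' → star (psiAB γ₁ γ₂ l) ⬝ᵥ psiAB γ₁ γ₂ l' = 0 := by
    intro l l' hl
    rw [hsum]
    have : (l = 0 ∧ l' = 1) ∨ (l = 0 ∧ l' = 2) ∨ (l = 1 ∧ l' = 2) := by omega
    rcases this with ⟨rfl, rfl⟩ | ⟨rfl, rfl⟩ | ⟨rfl, rfl⟩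
    · simp only [star_rowImage_zero_one, hzero]
      simp [Pi.single_apply]
    · simp only [star_rowImage_zero_two, hzero]
      simp [Pi.single_apply]
    · simp only [star_rowImage_one_two, hzero]
      simp [Pi.single_apply]
  rcases lt_trichotomy l l' with h | h | h
  · rw [key _ _ h, if_neg h.ne]
  · subst h
    rw [hsum, if_pos rfl]
    simp [star_rowImage_self _ _ h₁ h₂]
  · rw [Matrix.star_dotProduct, key _ _ h, if_neg h.ne', star_zero]

/-- One-way protocols without entanglement cannot achieve a fidelity close to one. -/
theorem exists_forall_outputFidelity_le (h₁ : ‖γ₁‖ = 1) (h₂ : ‖γ₂‖ = 1)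
    (hpos : γ₂ ≠ Complex.I * γ₁ ^ 2) (hneg : γ₂ ≠ -(Complex.I * γ₁ ^ 2)) :
    ∃ δ : ℝ, 0 < δ ∧
      ∀ Λ : BipartiteMap (C11 × Fin 1) (C11 × Fin 1) (Fin 1) ((C11 × C11) × Fin 1),
        OneWayLOCC _ _ _ _ Λ →
        outputFidelity Λ (initialState (psiRAB γ₁ γ₂) 1) (targetState (psiRAB γ₁ γ₂) 1) ≤
          1 - δ := by
  set s := (Complex.I * conj γ₁ ^ 2 * γ₂).im with hs
  have hs0 : s ≠ 0 := im_phase_ne_zero h₁ h₂ hpos hneg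
  set C : ℝ := 56 / s ^ 2 * (33 ^ 2 * 4 / 11) with hC
  have hC0 : 0 < C := by positivity
  -- This is the Cauchy–Schwarz bound `(∑ U)² / (C ∑ T)` with `∑ U = 2` and `∑ T = 11`, where `U`
  -- and `T` are the weights of a row on `ℂ^2` and on `ℂ^11`.
  refine ⟨4 / 11 / C, by positivity, fun Λ hΛ => ?_⟩
  obtain ⟨κ, _, ι, _, P, N, hP, hN, hfid⟩ := hΛ.exists_outputFidelity_eq
  set φ : κ → C11 → ℂ := fun k a => P k 0 (a, 0) with hφ
  set T : κ → ℝ := fun k => ∑ a, Complex.normSq (φ k a) with hT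
  set U : κ → ℝ := fun k => Complex.normSq (φ k (Sum.inl 0)) + Complex.normSq (φ k (Sum.inl 1))
    with hU
  set f : κ → ℝ := fun k => ∑ j, Complex.normSq (star (targetState (psiRAB γ₁ γ₂) 1) ⬝ᵥ
    applyLocal (P k ⊗ₖ N k j) (initialState (psiRAB γ₁ γ₂) 1)) with hf
  have hentry : ∀ a, ∑ k, Complex.normSq (φ k a) = 1 := fun a => hP.sum_normSq_entry (a, 0)
  have hTsum : ∑ k, T k = 11 := by
    rw [hT, Finset.sum_comm]
    simp only [hentry]
    norm_num
  have hUsum : ∑ k, U k = 2 := by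
    rw [hU, Finset.sum_add_distrib, hentry, hentry]
    norm_num
  have h33 : ((√33 : ℝ) : ℂ)⁻¹ * ((√33 : ℝ) : ℂ)⁻¹ = (33 : ℂ)⁻¹ := by
    rw [← mul_inv, ← Complex.ofReal_mul, Real.mul_self_sqrt (by norm_num)]
    norm_num
  have hbound : ∀ k, f k ≤ T k / 11 ∧ U k ^ 2 ≤ C * (T k * (T k / 11 - f k)) := by
    intro k
    set W : Fin 3 → C11 × Fin 1 → ℂ := fun l b =>
      (P k *ᵥ fun t => initialState (psiRAB γ₁ γ₂) 1 (l, t, b)) 0 with hW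
    have hWW : ∀ l l', star (W l) ⬝ᵥ W l' =
        (33 : ℂ)⁻¹ * (star (rowImage γ₁ γ₂ (φ k) l) ⬝ᵥ rowImage γ₁ γ₂ (φ k) l') := by
      intro l l'
      simp only [hW, initialState_row, dotProduct, Fintype.sum_prod_type _ (α₁ := C11),
        Fin.sum_univ_one, Pi.star_apply, Finset.mul_sum, star_mul', ← h33]
      refine Finset.sum_congr rfl fun b _ => ?_
      simp only [hφ, Complex.star_def, map_inv₀, Complex.conj_ofReal, Nat.cast_one, Real.sqrt_one,
        Complex.ofReal_one, inv_one, map_one]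
      ring
    have hmain := (hN k).normSq_star_dotProduct_le W
      (fun l j => targetState (psiRAB γ₁ γ₂) 1 (l, 0, j)) (S := T k / 11) (f := f k)
      (fun l l' hl => by
        rw [star_targetState_dotProduct, star_psiAB_dotProduct h₁ h₂, if_neg hl, mul_zero])
      (by simp [star_targetState_dotProduct, star_psiAB_dotProduct h₁ h₂])
      (by
        simp only [hWW, star_rowImage_self _ _ h₁ h₂, star_dotProduct_self, Finset.sum_const,
          Finset.card_univ, Fintype.card_fin, hT]
        push_cast
        ring)
      (by simp only [hf, star_dotProduct_applyLocal_kronecker, hW])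
    refine ⟨hmain.1, ?_⟩
    have hR : ∀ l l', l ≠ l' →
        Complex.normSq (star (rowImage γ₁ γ₂ (φ k) l) ⬝ᵥ rowImage γ₁ γ₂ (φ k) l') ≤
          33 ^ 2 * (4 * (T k / 11) * (T k / 11 - f k)) := by
      intro l l' hl
      have := hmain.2 l l' hl
      rw [hWW, map_mul] at this
      have e : Complex.normSq (33 : ℂ)⁻¹ = (33 ^ 2 : ℝ)⁻¹ := by
        rw [map_inv₀]; norm_num [Complex.normSq_apply]
      rw [e, inv_mul_le_iff₀ (by norm_num)] at this
      exact this
    have h01 := hR 0 1 (by decide)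
    have h02 := hR 0 2 (by decide)
    have h12 := hR 1 2 (by decide)
    rw [star_rowImage_zero_one] at h01
    rw [star_rowImage_zero_two] at h02
    rw [star_rowImage_one_two] at h12
    calc U k ^ 2 ≤ 56 / s ^ 2 * (33 ^ 2 * (4 * (T k / 11) * (T k / 11 - f k))) :=
          sq_normSq_add_normSq_le h₁ h₂ hs0 hs.symm _ _ _ h01 h02 h12
      _ = _ := by rw [hC]; ring
  -- Here `U² / T` is replaced by its tangent at the average ratio `U / T = 2 / 11`, so that the
  -- bounds can be added over the outcomes.
  have hlin : ∀ k, f k ≤ T k / 11 - (4 / 11 * U k - (2 / 11) ^ 2 * T k) / C := by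
    intro k
    obtain ⟨hfT, hUT⟩ := hbound k
    have hT0 : 0 ≤ T k := Finset.sum_nonneg fun _ _ => Complex.normSq_nonneg _
    rw [le_sub_comm, div_le_iff₀ hC0]
    rcases hT0.eq_or_lt with h0 | h0
    · have hU0 : U k = 0 := by
        rw [← h0] at hUT
        simpa using le_antisymm (by simpa using hUT) (sq_nonneg (U k))
      rw [hU0, ← h0]
      rw [← h0] at hfT
      nlinarith
    · refine le_of_mul_le_mul_left ?_ h0
      nlinarith [sq_nonneg (U k - 2 / 11 * T k)]
  rw [hfid]
  calc ∑ k, f k ≤ ∑ k, (T k / 11 - (4 / 11 * U k - (2 / 11) ^ 2 * T k) / C) :=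
        Finset.sum_le_sum fun k _ => hlin k
    _ = (∑ k, T k) / 11 - (4 / 11 * ∑ k, U k - (2 / 11) ^ 2 * ∑ k, T k) / C := by
        simp only [Finset.sum_sub_distrib, ← Finset.sum_div, ← Finset.mul_sum]
    _ = _ := by rw [hTsum, hUsum]; ring

end

/-! ### Protocols from orthogonal conditional states -/

section

variable {r x y a b b' : Type}

theorem IsMeasurement.comp_equiv {ι κ : Type} [Fintype ι] [Fintype κ] [Fintype x] [DecidableEq x]
    [Fintype y] {M : κ → Matrix y x ℂ} (hM : IsMeasurement M) (e : ι ≃ κ) :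
    IsMeasurement (M ∘ e) := by
  simp only [IsMeasurement] at hM ⊢
  rw [← hM]
  exact e.sum_comp fun k => (M k)ᴴ * M k

theorem isMeasurement_replicateRow {κ : Type} [Fintype κ] [Fintype x] [DecidableEq x]
    {φ : κ → x → ℂ} (h : ∀ i j, ∑ k, conj (φ k i) * φ k j = if i = j then 1 else 0) :
    IsMeasurement fun k => Matrix.replicateRow (Fin 1) (φ k) := by
  ext i j
  rw [Matrix.one_apply, ← h i j]
  simp [Matrix.sum_apply, Matrix.mul_apply]

/-- Orthogonal vectors of equal norm can be mapped by a measurement, with one outcome occurring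
with certainty, to multiples of any orthogonal vectors of equal norm. -/
theorem exists_isMeasurement_of_orthogonal [Fintype r] [DecidableEq r] [Nonempty r] [Fintype x]
    [DecidableEq x] [Fintype y] [DecidableEq y] [Nonempty y] (W : r → x → ℂ) (E : r → y → ℂ)
    {τ : ℝ} (hτ : 0 ≤ τ)
    (hW : ∀ s s', star (W s) ⬝ᵥ W s' = if s = s' then (τ : ℂ) else 0)
    (hE : ∀ s s', star (E s) ⬝ᵥ E s' = if s = s' then (Fintype.card r : ℂ)⁻¹ else 0) :
    ∃ (q : ℕ) (N : Fin q → Matrix y x ℂ), IsMeasurement N ∧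
      Fintype.card r * τ ≤ ∑ j, Complex.normSq (∑ s, star (E s) ⬝ᵥ (N j *ᵥ W s)) := by
  obtain ⟨d, hd⟩ : ∃ d : ℝ, d = (Fintype.card r : ℝ) := ⟨_, rfl⟩
  rw [← hd]
  have hd0 : 0 < d := by rw [hd]; exact_mod_cast Fintype.card_pos
  let Wm : Matrix x r ℂ := Matrix.of fun i s => W s i
  let Em : Matrix y r ℂ := Matrix.of fun i s => E s i
  have hWm : Wmᴴ * Wm = (τ : ℂ) • (1 : Matrix r r ℂ) := by
    ext s s'
    have := hW s s'
    simpa [Matrix.mul_apply, Matrix.one_apply, dotProduct, Wm] using this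
  have hEm : Emᴴ * Em = (d : ℂ)⁻¹ • (1 : Matrix r r ℂ) := by
    ext s s'
    have := hE s s'
    simpa [Matrix.mul_apply, Matrix.one_apply, dotProduct, Em, hd] using this
  -- This scaling makes `N₀` a partial isometry with initial projection `P` onto the span of `W`.
  -- For `τ = 0`, division by zero gives `c = 0` and `P = 0`, and the construction remains valid.
  set c : ℝ := √d / √τ with hc
  have hcτ : c ^ 2 * d⁻¹ = τ⁻¹ := by
    rw [hc, div_pow, Real.sq_sqrt hd0.le, Real.sq_sqrt hτ]
    field_simp
  have hcτ' : (c * τ) ^ 2 = d * τ := by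
    rw [hc, mul_pow, div_pow, Real.sq_sqrt hd0.le, Real.sq_sqrt hτ]
    rcases eq_or_ne τ 0 with h | h
    · simp [h]
    · field_simp
  set N₀ : Matrix y x ℂ := (c : ℂ) • (Em * Wmᴴ) with hN₀
  set P : Matrix x x ℂ := (τ : ℂ)⁻¹ • (Wm * Wmᴴ) with hP
  have hN₀P : N₀ᴴ * N₀ = P := by
    calc N₀ᴴ * N₀ = ((c : ℂ) * c) • (Wm * (Emᴴ * Em) * Wmᴴ) := by
          simp only [hN₀, Matrix.conjTranspose_smul, Matrix.conjTranspose_mul,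
            Matrix.conjTranspose_conjTranspose, Complex.star_def, Complex.conj_ofReal,
            Matrix.smul_mul, Matrix.mul_smul, smul_smul, Matrix.mul_assoc]
      _ = ((c ^ 2 * d⁻¹ : ℝ) : ℂ) • (Wm * Wmᴴ) := by
          rw [hEm, Matrix.mul_smul, Matrix.mul_one, Matrix.smul_mul, smul_smul]
          push_cast
          ring_nf
      _ = P := by rw [hcτ, hP]; push_cast; rfl
  have hPP : P * P = P := by
    calc P * P = ((τ : ℂ)⁻¹ * (τ : ℂ)⁻¹) • (Wm * (Wmᴴ * Wm) * Wmᴴ) := by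
          simp only [hP, Matrix.smul_mul, Matrix.mul_smul, smul_smul, Matrix.mul_assoc]
      _ = P := by
          rw [hWm, Matrix.mul_smul, Matrix.mul_one, Matrix.smul_mul, smul_smul, hP]
          congr 1
          rcases eq_or_ne (τ : ℂ) 0 with h | h
          · simp [h]
          · field_simp
  have hPH : Pᴴ = P := by
    simp [hP, Matrix.conjTranspose_smul, Matrix.conjTranspose_mul]
  obtain ⟨y₀⟩ := ‹Nonempty y›
  -- The complement of `P` is sent to a fixed basis vector; these outcomes only complete the
  -- measurement.
  let N : Option x → Matrix y x ℂ := fun i =>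
    i.elim N₀ fun i => Matrix.single y₀ i (1 : ℂ) * (1 - P)
  have hN : IsMeasurement N := by
    have h1 : ∀ i : x, (Matrix.single y₀ i (1 : ℂ) * (1 - P))ᴴ *
        (Matrix.single y₀ i (1 : ℂ) * (1 - P)) =
          (1 - P) * Matrix.single i i (1 : ℂ) * (1 - P) := by
      intro i
      rw [Matrix.conjTranspose_mul, Matrix.conjTranspose_sub, hPH, Matrix.conjTranspose_one,
        Matrix.conjTranspose_single, Matrix.mul_assoc, ← Matrix.mul_assoc (Matrix.single i y₀ _),
        Matrix.single_mul_single_same, Matrix.mul_assoc]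
      simp
    have h2 : ∑ i : x, Matrix.single i i (1 : ℂ) = 1 := by
      ext i j
      simp [Matrix.sum_apply, Matrix.single_apply, Matrix.one_apply, ite_and]
    rw [IsMeasurement, Fintype.sum_option]
    simp only [N, Option.elim, h1, hN₀P]
    rw [← Matrix.sum_mul, ← Matrix.mul_sum, h2, Matrix.mul_one, Matrix.mul_sub, Matrix.sub_mul,
      Matrix.sub_mul, hPP]
    simp
  have hval : ∑ s, star (E s) ⬝ᵥ (N none *ᵥ W s) = ((c * τ : ℝ) : ℂ) := by
    calc ∑ s, star (E s) ⬝ᵥ (N none *ᵥ W s) = (Emᴴ * (N₀ * Wm)).trace := by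
          simp only [Matrix.trace, Matrix.diag, Matrix.mul_apply, Matrix.conjTranspose_apply,
            dotProduct, Matrix.mulVec, Pi.star_apply, N, Option.elim, Em, Wm, Matrix.of_apply]
      _ = (c : ℂ) * ((Emᴴ * Em) * (Wmᴴ * Wm)).trace := by
          rw [hN₀, Matrix.smul_mul, Matrix.mul_smul, Matrix.trace_smul, smul_eq_mul]
          simp only [Matrix.mul_assoc]
      _ = _ := by
          rw [hEm, hWm, Matrix.smul_mul, Matrix.one_mul, Matrix.trace_smul, Matrix.trace_smul,
            Matrix.trace_one, smul_eq_mul, smul_eq_mul]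
          have : (Fintype.card r : ℂ) = (d : ℂ) := by simp [hd]
          have hd' : (d : ℂ) ≠ 0 := by exact_mod_cast hd0.ne'
          rw [this]
          push_cast
          field_simp
  let e := (Fintype.equivFin (Option x)).symm
  refine ⟨_, N ∘ e, hN.comp_equiv e, ?_⟩
  rw [show ∑ j, Complex.normSq (∑ s, star (E s) ⬝ᵥ ((N ∘ e) j *ᵥ W s)) =
    ∑ j, Complex.normSq (∑ s, star (E s) ⬝ᵥ (N j *ᵥ W s)) from
    e.sum_comp fun j => Complex.normSq (∑ s, star (E s) ⬝ᵥ (N j *ᵥ W s))]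
  refine le_trans (le_of_eq ?_) (Finset.single_le_sum
    (f := fun j => Complex.normSq (∑ s, star (E s) ⬝ᵥ (N j *ᵥ W s)))
    (fun _ _ => Complex.normSq_nonneg _) (Finset.mem_univ none))
  rw [hval, Complex.normSq_ofReal, ← pow_two, hcτ']

variable [Fintype r] [DecidableEq r] [Nonempty r] [Fintype a] [DecidableEq a] [Fintype b]
  [DecidableEq b] [Fintype b'] [DecidableEq b'] [Nonempty b']

/-- If the measurement of `A` with operators of rank one leaves `B` with orthogonal vectors of
equal norm, `B` can restore the target state. -/
theorem exists_isLOCC_sender {κ : Type} [Fintype κ] {n : ℕ} (hn : Fintype.card κ = n)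
    (φ : κ → a → ℂ) (hφ : IsMeasurement fun k => Matrix.replicateRow (Fin 1) (φ k))
    (Φ : r × a × b → ℂ) (Ψ : r × Fin 1 × b' → ℂ)
    (hΨ : ∀ s s', star (fun j => Ψ (s, 0, j)) ⬝ᵥ (fun j => Ψ (s', 0, j)) =
      if s = s' then (Fintype.card r : ℂ)⁻¹ else 0)
    (hΦ : ∀ k, ∃ τ : ℂ, ∀ s s', star (fun i => ∑ t, φ k t * Φ (s, t, i)) ⬝ᵥ
      (fun i => ∑ t, φ k t * Φ (s', t, i)) = if s = s' then τ else 0) :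
    ∃ Λ : BipartiteMap a b (Fin 1) b', IsLOCC [(Party.A, n)] Λ ∧
      ∑ t, Complex.normSq (Φ t) ≤ outputFidelity Λ Φ Ψ := by
  set W : κ → r → b → ℂ := fun k s i => ∑ t, φ k t * Φ (s, t, i) with hW
  have hN : ∀ k, ∃ (q : ℕ) (N : Fin q → Matrix b' b ℂ), IsMeasurement N ∧
      ∑ s, ∑ i, Complex.normSq (W k s i) ≤
        ∑ j, Complex.normSq (∑ s, star (fun j => Ψ (s, 0, j)) ⬝ᵥ (N j *ᵥ W k s)) := by
    intro k
    obtain ⟨τ, hτ⟩ := hΦ k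
    have hs : ∀ s, ((∑ i, Complex.normSq (W k s i) : ℝ) : ℂ) = τ := by
      intro s
      rw [← star_dotProduct_self, hτ, if_pos rfl]
    obtain ⟨s₀⟩ := ‹Nonempty r›
    have hs' : ∀ s, ∑ i, Complex.normSq (W k s i) = ∑ i, Complex.normSq (W k s₀ i) := by
      intro s
      exact_mod_cast (hs s).trans (hs s₀).symm
    have : Nonempty r := ⟨s₀⟩
    obtain ⟨q, N, hN, h⟩ := exists_isMeasurement_of_orthogonal (W k) (fun s j => Ψ (s, 0, j))
      (τ := ∑ i, Complex.normSq (W k s₀ i))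
      (Finset.sum_nonneg fun _ _ => Complex.normSq_nonneg _)
      (fun s s' => by rw [hs, hτ]) hΨ
    refine ⟨q, N, hN, ?_⟩
    simp only [hs', Finset.sum_const, Finset.card_univ, nsmul_eq_mul]
    exact h
  choose q N hN hle using hN
  let e : Fin n ≃ κ := (Fintype.equivFinOfCardEq hn).symm
  let Λ' : κ → BipartiteMap (Fin 1) b (Fin 1) b' := fun k ρ =>
    ∑ _i : Fin 1, ∑ j, ((1 : Matrix (Fin 1) (Fin 1) ℂ) ⊗ₖ N k j) * ρ *
      ((1 : Matrix (Fin 1) (Fin 1) ℂ) ⊗ₖ N k j)ᴴ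
  let M : κ → Matrix (Fin 1) a ℂ := fun k => Matrix.replicateRow (Fin 1) (φ k)
  refine ⟨fun ρ => ∑ m, (Λ' ∘ e) m (((M ∘ e) m ⊗ₖ (1 : Matrix b b ℂ)) * ρ *
    ((M ∘ e) m ⊗ₖ (1 : Matrix b b ℂ))ᴴ), ?_, ?_⟩
  · refine ⟨1, M ∘ e, Λ' ∘ e, hφ.comp_equiv e, fun m => ?_, fun ρ => rfl⟩
    exact ⟨1, q (e m), fun _ => 1, N (e m), by simp [IsMeasurement], hN _, fun ρ => rfl⟩
  · rw [outputFidelity_sum_conjugate (Λ' ∘ e) (fun m => (M ∘ e) m ⊗ₖ (1 : Matrix b b ℂ))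
      (fun ρ => rfl)]
    -- By completeness of the measurement of `A`, the conditional vectors carry the whole norm of
    -- `Φ`.
    have h1 : ∑ t, Complex.normSq (Φ t) = ∑ k, ∑ s, ∑ i, Complex.normSq (W k s i) := by
      rw [Fintype.sum_prod_type, Finset.sum_comm (s := (Finset.univ : Finset κ))]
      refine Finset.sum_congr rfl fun s _ => ?_
      rw [Fintype.sum_prod_type_right, Finset.sum_comm (s := (Finset.univ : Finset κ))]
      refine Finset.sum_congr rfl fun i _ => ?_
      rw [← hφ.sum_normSq_row]
      rfl
    rw [h1, ← e.sum_comp]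
    refine Finset.sum_le_sum fun m _ => (hle (e m)).trans (le_of_eq ?_)
    rw [outputFidelity_local (Λ := (Λ' ∘ e) m) (fun _ : Fin 1 => (1 : Matrix (Fin 1) (Fin 1) ℂ))
      (N (e m)) (fun ρ => rfl), Fin.sum_univ_one]
    refine Finset.sum_congr rfl fun j _ => ?_
    rw [applyLocal_applyLocal, ← Matrix.mul_kronecker_mul, Matrix.one_mul, Matrix.mul_one,
      star_dotProduct_applyLocal_kronecker]
    rfl

/-- The protocol of `exists_isLOCC_sender`, preceded by a measurement of `B`. -/
theorem exists_isLOCC_receiver_sender {κ : Type} [Fintype κ] {n n' c : ℕ}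
    (hn : Fintype.card κ = n) (M : Fin n' → Matrix (Fin c) b ℂ) (hM : IsMeasurement M)
    (φ : Fin n' → κ → a → ℂ)
    (hφ : ∀ m, IsMeasurement fun k => Matrix.replicateRow (Fin 1) (φ m k))
    (Φ : r × a × b → ℂ) (Ψ : r × Fin 1 × b' → ℂ)
    (hΨ : ∀ s s', star (fun j => Ψ (s, 0, j)) ⬝ᵥ (fun j => Ψ (s', 0, j)) =
      if s = s' then (Fintype.card r : ℂ)⁻¹ else 0)
    (hΦ : ∀ m k, ∃ τ : ℂ, ∀ s s',
      star (fun i => ∑ t, φ m k t * (M m *ᵥ fun j => Φ (s, t, j)) i) ⬝ᵥ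
      (fun i => ∑ t, φ m k t * (M m *ᵥ fun j => Φ (s', t, j)) i) = if s = s' then τ else 0) :
    ∃ Λ : BipartiteMap a b (Fin 1) b', IsLOCC [(Party.B, n'), (Party.A, n)] Λ ∧
      ∑ t, Complex.normSq (Φ t) ≤ outputFidelity Λ Φ Ψ := by
  have happly : ∀ m, applyLocal ((1 : Matrix a a ℂ) ⊗ₖ M m) Φ =
      fun t => (M m *ᵥ fun j => Φ (t.1, t.2.1, j)) t.2.2 := by
    intro m
    funext ⟨s, t, i⟩
    simp only [applyLocal, kronecker_mulVec_apply, Matrix.one_mulVec]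
  choose Λ' hΛ' hle using fun m => exists_isLOCC_sender (b' := b') hn (φ m) (hφ m)
    (applyLocal ((1 : Matrix a a ℂ) ⊗ₖ M m) Φ) Ψ hΨ
    (fun k => by simpa only [happly] using hΦ m k)
  refine ⟨fun ρ => ∑ m, Λ' m (((1 : Matrix a a ℂ) ⊗ₖ M m) * ρ *
    ((1 : Matrix a a ℂ) ⊗ₖ M m)ᴴ), ⟨c, M, Λ', hM, hΛ', fun ρ => rfl⟩, ?_⟩
  rw [outputFidelity_sum_conjugate Λ' (fun m => (1 : Matrix a a ℂ) ⊗ₖ M m) (fun ρ => rfl)]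
  refine le_trans (le_of_eq ?_) (Finset.sum_le_sum fun m _ => hle m)
  simp only [happly, Fintype.sum_prod_type]
  rw [Finset.sum_comm (s := (Finset.univ : Finset (Fin n')))]
  refine Finset.sum_congr rfl fun s _ => ?_
  rw [Finset.sum_comm (s := (Finset.univ : Finset (Fin n')))]
  refine Finset.sum_congr rfl fun t _ => ?_
  rw [hM.sum_normSq]

end

/-! ### Gram matrices and normalization of the initial state -/

section

variable {γ₁ γ₂ : ℂ}

theorem conj_mul_self_of_norm_eq_one {γ : ℂ} (h : ‖γ‖ = 1) : conj γ * γ = 1 := by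
  rw [← Complex.normSq_eq_conj_mul_self, Complex.normSq_eq_norm_sq, h]; simp

theorem eq_ite_of_hermitian {f : Fin 3 → Fin 3 → ℂ} {τ : ℂ} (hf : ∀ s s', f s' s = star (f s s'))
    (hτ : ∀ s, f s s = τ) (h01 : f 0 1 = 0) (h02 : f 0 2 = 0) (h12 : f 1 2 = 0) (s s' : Fin 3) :
    f s s' = if s = s' then τ else 0 := by
  have h10 := hf 0 1
  have h20 := hf 0 2
  have h21 := hf 1 2
  rw [h01, star_zero] at h10
  rw [h02, star_zero] at h20
  rw [h12, star_zero] at h21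
  fin_cases s <;> fin_cases s' <;> simp [hτ, h01, h02, h12, h10, h20, h21]

theorem sum_normSq_initialState (h₁ : ‖γ₁‖ = 1) (h₂ : ‖γ₂‖ = 1) {K : ℕ} (hK : 0 < K) :
    ∑ t, Complex.normSq (initialState (psiRAB γ₁ γ₂) K t) = 1 := by
  have hψ : ∀ l, ∑ a, ∑ b, Complex.normSq (psiAB γ₁ γ₂ l (a, b)) = 1 := by
    intro l
    have := star_psiAB_dotProduct h₁ h₂ l l
    rw [star_dotProduct_self, if_pos rfl, Fintype.sum_prod_type] at this
    exact_mod_cast this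
  have hm : ∀ k : Fin K, ∑ k', Complex.normSq (maxEntangled K (k, k')) = (K : ℝ)⁻¹ := by
    intro k
    simp [maxEntangled, apply_ite]
  calc _ = ∑ l, ∑ a, ∑ k, ∑ b, ∑ k', (3 : ℝ)⁻¹ * (Complex.normSq (psiAB γ₁ γ₂ l (a, b)) *
        Complex.normSq (maxEntangled K (k, k'))) := by
        simp only [Fintype.sum_prod_type (α₁ := Fin 3), Fintype.sum_prod_type (α₁ := C11 × Fin K),
          Fintype.sum_prod_type (α₁ := C11), initialState, psiRAB, map_mul, map_inv₀,
          Complex.normSq_ofReal, Real.mul_self_sqrt (show (0 : ℝ) ≤ 3 by norm_num), mul_assoc]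
    _ = 1 := by
        have hK' : (K : ℝ) ≠ 0 := by exact_mod_cast hK.ne'
        simp only [← Finset.mul_sum, hm, ← Finset.sum_mul, Finset.sum_const, Finset.card_univ,
          Fintype.card_fin, nsmul_eq_mul]
        simp only [mul_comm _ ((K : ℝ)⁻¹), ← mul_assoc, hψ]
        simp [hK']

theorem sum_mul_initialState (K : ℕ) (φ : C11 × Fin K → ℂ) (l : Fin 3) (b : C11 × Fin K) :
    ∑ t, φ t * initialState (psiRAB γ₁ γ₂) K (l, t, b) =
      ((√33 : ℝ) : ℂ)⁻¹ * ((√(K : ℝ) : ℝ) : ℂ)⁻¹ *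
        rowImage γ₁ γ₂ (fun a => φ (a, b.2)) l b.1 :=
  initialState_row γ₁ γ₂ K (Matrix.replicateRow (Fin 1) φ) l b

/-! ### One ebit and one-way communication -/

/-- The Bell basis of `ℂ^2 ⊗ ℂ^2` together with the product basis of `ℂ^9 ⊗ ℂ^2`. -/
def bellRow : (Fin 2 × Fin 2) ⊕ (Fin 9 × Fin 2) → C11 × Fin 2 → ℂ
  | Sum.inl (p, q), (Sum.inl i, k) =>
      if k = i + p then ((√2 : ℝ) : ℂ)⁻¹ * (-1) ^ ((q : ℕ) * (i : ℕ)) else 0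
  | Sum.inr (j, k'), (Sum.inr b, k) => if b = j ∧ k = k' then 1 else 0
  | _, _ => 0

theorem inv_sqrt_two_mul_self : ((√2 : ℝ) : ℂ)⁻¹ * ((√2 : ℝ) : ℂ)⁻¹ = 2⁻¹ := by
  rw [← mul_inv, ← Complex.ofReal_mul, Real.mul_self_sqrt (by norm_num)]
  norm_num

theorem isMeasurement_bellRow :
    IsMeasurement fun k => Matrix.replicateRow (Fin 1) (bellRow k) := by
  have h2 := inv_sqrt_two_mul_self
  refine isMeasurement_replicateRow fun i j => ?_
  rcases i with ⟨i | i, k⟩ <;> rcases j with ⟨j | j, k'⟩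
  · fin_cases i <;> fin_cases j <;> fin_cases k <;> fin_cases k' <;>
      simp [bellRow, Fintype.sum_prod_type, h2] <;> norm_num
  · simp [bellRow]
  · simp [bellRow]
  · simp [bellRow, Fintype.sum_prod_type, ite_and, Prod.ext_iff]
    split_ifs <;> simp

/-- The Gram matrix left by a row is the sum over the basis of the ebit half of `B`. For Bell rows
`X` and `Y` vanish termwise and `Z` cancels in the sum; product rows have neither a part on `ℂ^2`
nor autocorrelation. The count is `22 = 4 + 18`. -/
theorem exists_isLOCC_one_ebit (h₁ : ‖γ₁‖ = 1) (h₂ : ‖γ₂‖ = 1) :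
    ∃ Λ : BipartiteMap (C11 × Fin 2) (C11 × Fin 2) (Fin 1) ((C11 × C11) × Fin 1),
      IsLOCC [(Party.A, 22)] Λ ∧ 1 ≤ outputFidelity Λ (initialState (psiRAB γ₁ γ₂) 2)
        (targetState (psiRAB γ₁ γ₂) 1) := by
  rw [← sum_normSq_initialState h₁ h₂ (show 0 < 2 by norm_num)]
  refine exists_isLOCC_sender (by simp) bellRow isMeasurement_bellRow _ _ (fun s s' => ?_)
    fun k => ?_
  · rw [star_targetState_dotProduct, star_psiAB_dotProduct h₁ h₂]
    simp
  · set c : ℂ := ((√33 : ℝ) : ℂ)⁻¹ * ((√((2 : ℕ) : ℝ) : ℝ) : ℂ)⁻¹ with hc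
    have hstar : star c = c := by
      simp only [hc, star_mul', Complex.star_def, map_inv₀, Complex.conj_ofReal]
    have hgram : ∀ s s', star (fun i => ∑ t, bellRow k t *
        initialState (psiRAB γ₁ γ₂) 2 (s, t, i)) ⬝ᵥ
        (fun i => ∑ t, bellRow k t * initialState (psiRAB γ₁ γ₂) 2 (s', t, i)) =
        c * c * ∑ k', star (rowImage γ₁ γ₂ (fun a => bellRow k (a, k')) s) ⬝ᵥ
          rowImage γ₁ γ₂ (fun a => bellRow k (a, k')) s' := by
      intro s s'
      simp only [sum_mul_initialState, ← hc]
      simp only [dotProduct, Fintype.sum_prod_type_right, Pi.star_apply,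
        star_mul', hstar, Finset.mul_sum]
      refine Finset.sum_congr rfl fun k' _ => Finset.sum_congr rfl fun b _ => ?_
      ring
    refine ⟨c * c * ∑ k', star (fun a => bellRow k (a, k')) ⬝ᵥ fun a => bellRow k (a, k'), ?_⟩
    have hzero : ∀ j k' k'' (b : Fin 9), conj (bellRow (Sum.inr (j, k')) (Sum.inr b, k'')) *
        bellRow (Sum.inr (j, k')) (Sum.inr (b + 3), k'') = 0 := by
      have hne : ∀ b : Fin 9, b + 3 ≠ b := by decide
      intro j k' k'' b
      by_cases hb : b = j
      · subst hb
        simp [bellRow, hne]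
      · simp [bellRow, hb]
    refine eq_ite_of_hermitian (fun s s' => Matrix.star_dotProduct _ _) (fun s => ?_) ?_ ?_ ?_
    · rw [hgram]
      simp only [star_rowImage_self _ _ h₁ h₂]
    · rw [hgram]
      simp only [star_rowImage_zero_one]
      rcases k with ⟨p, q⟩ | ⟨j, k'⟩
      · fin_cases p <;> simp [bellRow]
      · simp only [hzero, Finset.sum_const_zero]
        simp [bellRow]
    · rw [hgram]
      simp only [star_rowImage_zero_two]
      rcases k with ⟨p, q⟩ | ⟨j, k'⟩
      · fin_cases p <;> fin_cases q <;> simp [bellRow]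
      · simp only [hzero, Finset.sum_const_zero]
        simp [bellRow]
    · rw [hgram]
      simp only [star_rowImage_one_two]
      rcases k with ⟨p, q⟩ | ⟨j, k'⟩
      · fin_cases p <;> simp [bellRow]
      · simp only [hzero, Finset.sum_const_zero]
        simp [bellRow]

end

section

variable {γ₁ γ₂ : ℂ}

/-! ### No entanglement and two rounds of communication -/

/-- Measurement operators that are diagonal in the computational basis. -/
def diagonalOperator {x : Type} [Fintype x] [DecidableEq x] (d : x → ℂ) :
    Matrix (Fin (Fintype.card x)) x ℂ :=
  (Matrix.diagonal d).submatrix (Fintype.equivFin x).symm id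

theorem diagonalOperator_mulVec {x : Type} [Fintype x] [DecidableEq x] (d v : x → ℂ)
    (i : Fin (Fintype.card x)) :
    (diagonalOperator d *ᵥ v) i =
      d ((Fintype.equivFin x).symm i) * v ((Fintype.equivFin x).symm i) :=
  Matrix.mulVec_diagonal d v _

theorem isMeasurement_diagonalOperator {ι x : Type} [Fintype ι] [Fintype x] [DecidableEq x]
    {d : ι → x → ℂ} (hd : ∀ i, ∑ m, conj (d m i) * d m i = 1) :
    IsMeasurement fun m => diagonalOperator (d m) := by
  have h : ∀ m, (diagonalOperator (d m))ᴴ * diagonalOperator (d m) =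
      Matrix.diagonal fun i => conj (d m i) * d m i := by
    intro m
    rw [diagonalOperator, Matrix.conjTranspose_submatrix, Matrix.submatrix_mul_equiv,
      Matrix.diagonal_conjTranspose, Matrix.diagonal_mul_diagonal]
    rfl
  ext i j
  simp only [h, Matrix.sum_apply, Matrix.diagonal_apply, Matrix.one_apply]
  split_ifs with hij
  · exact hd i
  · simp

/-- The block `{3m, 3m + 1, 3m + 2}` that contains `b`, and the position of `b` in it. -/
def blockIndex (b : Fin 9) : Fin 3 × Fin 3 :=
  (⟨b / 3, by omega⟩, ⟨b % 3, by omega⟩)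

/-- The measurement of `B`: an attenuation on `ℂ^2` and the projection to a block of `ℂ^9`. -/
def blockWeight (m : Fin 3) (i : C11 × Fin 1) : ℂ :=
  Sum.elim (fun _ => ((√3 : ℝ) : ℂ)⁻¹) (fun b => if (blockIndex b).1 = m then 1 else 0) i.1

theorem inv_sqrt_three_mul_self : ((√3 : ℝ) : ℂ)⁻¹ * ((√3 : ℝ) : ℂ)⁻¹ = 3⁻¹ := by
  rw [← mul_inv, ← Complex.ofReal_mul, Real.mul_self_sqrt (by norm_num)]
  norm_num

theorem sum_blockWeight (i : C11 × Fin 1) :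
    ∑ m, conj (blockWeight m i) * blockWeight m i = 1 := by
  have h3 := inv_sqrt_three_mul_self
  rcases i with ⟨i | i, _⟩
  · simp [blockWeight, h3]
  · simp [blockWeight]

/-- A row vector of `A` with component `u` on `ℂ^2`, whose component on `ℂ^9` consists of the
blocks `V j`, shifted by `m` blocks. -/
def blockRow (m : Fin 3) (u : Fin 2 → ℂ) (V : Fin 3 → Fin 3 → ℂ) (i : C11 × Fin 1) : ℂ :=
  Sum.elim u (fun b => V ((blockIndex b).1 - m) (blockIndex b).2) i.1

theorem sum_ite_block (m : Fin 3) (g : Fin 3 → ℂ) :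
    ∑ b, (if (blockIndex b).1 = m then g (blockIndex b).2 else 0) = ∑ c, g c := by
  fin_cases m <;> simp [Fin.sum_univ_succ, blockIndex]

theorem blockIndex_add_three (b : Fin 9) :
    blockIndex (b + 3) = ((blockIndex b).1 + 1, (blockIndex b).2) := by
  revert b; decide

theorem blockIndex_add_six (b : Fin 9) :
    blockIndex (b + 6) = ((blockIndex b).1 + 2, (blockIndex b).2) := by
  revert b; decide

theorem blockIndex_injective : Function.Injective blockIndex := by
  decide

/-- The vector of `B` that is left from `|ψ_l⟩` after `B` has obtained the outcome `m` and `A` has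
applied a row vector with components `u` and `V`. -/
def blockImage (γ₁ γ₂ : ℂ) (u : Fin 2 → ℂ) (V : Fin 3 → Fin 3 → ℂ) (l : Fin 3) :
    Fin 2 ⊕ Fin 3 → ℂ :=
  Sum.elim (fun i => ((√3 : ℝ) : ℂ)⁻¹ * ![u i, γ₁ * u (i + 1), γ₂ * ((-1) ^ (i : ℕ) * u i)] l) (V l)

/-- The shift by `3l` moves block `m + l` of the row onto block `m`, the one `B` selected. The state
`ψ_l` therefore sees only `V l`, and the result does not depend on `m`. -/
theorem star_blockWeight_mul_rowImage (m : Fin 3) (u : Fin 2 → ℂ) (V : Fin 3 → Fin 3 → ℂ)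
    (l l' : Fin 3) :
    star (fun i : C11 × Fin 1 => blockWeight m i *
      rowImage γ₁ γ₂ (fun a => blockRow m u V (a, i.2)) l i.1) ⬝ᵥ
      (fun i : C11 × Fin 1 => blockWeight m i *
        rowImage γ₁ γ₂ (fun a => blockRow m u V (a, i.2)) l' i.1) =
      star (blockImage γ₁ γ₂ u V l) ⬝ᵥ blockImage γ₁ γ₂ u V l' := by
  have hW : ∀ l b, blockWeight m (Sum.inr b, 0) *
      rowImage γ₁ γ₂ (fun a => blockRow m u V (a, 0)) l (Sum.inr b) =
        if (blockIndex b).1 = m then V l (blockIndex b).2 else 0 := by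
    intro l b
    by_cases h : (blockIndex b).1 = m
    · fin_cases l <;>
        simp [blockWeight, rowImage, blockRow, blockIndex_add_three, blockIndex_add_six, h]
    · simp [blockWeight, h]
  have hW' : ∀ l i, blockWeight m (Sum.inl i, 0) *
      rowImage γ₁ γ₂ (fun a => blockRow m u V (a, 0)) l (Sum.inl i) =
        blockImage γ₁ γ₂ u V l (Sum.inl i) := by
    intro l i
    fin_cases l <;> simp [blockWeight, rowImage, blockRow, blockImage]
  simp only [dotProduct, Fintype.sum_prod_type, Fin.sum_univ_one, Fintype.sum_sum_type, hW, hW',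
    Pi.star_apply]
  congr 1
  rw [← sum_ite_block m]
  refine Finset.sum_congr rfl fun b _ => ?_
  split_ifs <;> simp [blockImage]

/-- A primitive cube root of unity. -/
def cubeRoot : ℂ := ⟨-1 / 2, √3 / 2⟩

theorem one_add_cubeRoot_add_sq : 1 + cubeRoot + cubeRoot ^ 2 = 0 := by
  have := Real.sq_sqrt (show (0 : ℝ) ≤ 3 by norm_num)
  apply Complex.ext
  · simp [cubeRoot, pow_two]; nlinarith
  · simp [cubeRoot, pow_two]; ring

theorem conj_cubeRoot : conj cubeRoot = cubeRoot ^ 2 := by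
  have := Real.sq_sqrt (show (0 : ℝ) ≤ 3 by norm_num)
  apply Complex.ext
  · simp [cubeRoot, pow_two]; nlinarith
  · simp [cubeRoot, pow_two]; ring

/-- The amplitudes of the first three blocks of the row vectors of `A`. -/
def blockPhase (γ₂ : ℂ) (e : Fin 2) (q : Fin 4) : Fin 3 → ℂ :=
  ![Complex.I ^ (q : ℕ) / 6, (-1) ^ (q : ℕ) / 6,
    -((-1) ^ (e : ℕ) * γ₂ * Complex.I ^ (q : ℕ) / 6)]

/-- The index set of the outcomes of `A`. -/
abbrev SenderIndex : Type := (Fin 2 × Fin 3 × Fin 4) ⊕ (Fin 3 × Fin 3)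

/-- The components on `ℂ^2` of the row vectors of `A`. -/
def senderQubit : SenderIndex → Fin 2 → ℂ
  | Sum.inl (e, _, _), i => if i = e then ((√3 : ℝ) : ℂ)⁻¹ / 2 else 0
  | Sum.inr _, _ => 0

/-- The components on `ℂ^9` of the row vectors of `A`. -/
def senderBlock (γ₂ : ℂ) : SenderIndex → Fin 3 → Fin 3 → ℂ
  | Sum.inl (e, p, q), j, c => if c = p + ![0, 1, 0] j then blockPhase γ₂ e q j else 0
  | Sum.inr (p, q), j, c =>
      if c = p + j then ((√(7 / 27) : ℝ) : ℂ) * cubeRoot ^ ((q : ℕ) * (j : ℕ)) else 0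

/-- The phases in `q` decouple block 1 from blocks 0 and 2, and the sign in `e` decouples block 0
from block 2. Each diagonal term is `8 / 36`. -/
theorem sum_blockPhase (γ₂ : ℂ) (h₂ : ‖γ₂‖ = 1) (j j' : Fin 3) :
    ∑ e, ∑ q, conj (blockPhase γ₂ e q j) * blockPhase γ₂ e q j' =
      if j = j' then 2 / 9 else 0 := by
  have h := conj_mul_self_of_norm_eq_one h₂
  have h6 : conj (6 : ℂ) = 6 := map_ofNat _ 6
  fin_cases j <;> fin_cases j' <;>
    simp [blockPhase, Fin.sum_univ_succ, pow_succ, h6]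
  all_goals ring_nf
  all_goals simp only [Complex.I_sq]
  · norm_num
  · linear_combination 2 / 9 * h

/-- Orthogonality of the characters of `ℤ/3`. The weight `7 / 9` is what the rows meeting `ℂ^2`
leave missing on `ℂ^9`. -/
theorem sum_cubeRoot (j j' : Fin 3) :
    ∑ q : Fin 3, conj (((√(7 / 27) : ℝ) : ℂ) * cubeRoot ^ ((q : ℕ) * (j : ℕ))) *
      (((√(7 / 27) : ℝ) : ℂ) * cubeRoot ^ ((q : ℕ) * (j' : ℕ))) =
      if j = j' then 7 / 9 else 0 := by
  have h7 : ((√(7 / 27) : ℝ) : ℂ) * ((√(7 / 27) : ℝ) : ℂ) = 7 / 27 := by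
    rw [← Complex.ofReal_mul, Real.mul_self_sqrt (by norm_num)]
    norm_num
  have h0 := one_add_cubeRoot_add_sq
  have h3 : cubeRoot ^ 3 = 1 := by linear_combination (cubeRoot - 1) * h0
  have hterm : ∀ q : Fin 3, conj (((√(7 / 27) : ℝ) : ℂ) * cubeRoot ^ ((q : ℕ) * (j : ℕ))) *
      (((√(7 / 27) : ℝ) : ℂ) * cubeRoot ^ ((q : ℕ) * (j' : ℕ))) =
      7 / 27 * (cubeRoot ^ (2 * (j : ℕ) + (j' : ℕ))) ^ (q : ℕ) := by
    intro q
    rw [map_mul, map_pow, conj_cubeRoot, Complex.conj_ofReal, ← h7]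
    ring
  simp only [hterm]
  have h6 : cubeRoot ^ 6 = 1 := by linear_combination (cubeRoot ^ 3 + 1) * h3
  fin_cases j <;> fin_cases j' <;> simp [Fin.sum_univ_succ]
  · norm_num
  · linear_combination 7 / 27 * h0
  · linear_combination 7 / 27 * h0 + 7 / 27 * cubeRoot * h3
  · linear_combination 7 / 27 * h0 + 7 / 27 * cubeRoot * h3
  · linear_combination (7 / 27 * (cubeRoot ^ 3 + 2)) * h3
  · linear_combination 7 / 27 * h0 +
      (7 / 27 * cubeRoot + 7 / 27 * cubeRoot ^ 2 * (cubeRoot ^ 3 + 1)) * h3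
  · linear_combination 7 / 27 * h0 +
      (7 / 27 * cubeRoot + 7 / 27 * cubeRoot ^ 2 * (cubeRoot ^ 3 + 1)) * h3
  · linear_combination 7 / 27 * h0 + (7 / 27 * cubeRoot ^ 2 +
      7 / 27 * cubeRoot * (cubeRoot ^ 6 + cubeRoot ^ 3 + 1)) * h3
  · linear_combination (7 / 27 * (cubeRoot ^ 6 + 2)) * h6

theorem sum_shift (d c c' : Fin 3) :
    ∑ p, (if c = p + d then (1 : ℂ) else 0) * (if c' = p + d then 1 else 0) =
      if c = c' then 1 else 0 := by
  have h : ∀ c p : Fin 3, c = p + d ↔ p = c - d := fun c p =>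
    ⟨fun h => by rw [h, add_sub_cancel_right], fun h => by rw [h, sub_add_cancel]⟩
  simp only [h]
  simp [eq_comm]

theorem sum_senderQubit (i i' : Fin 2) :
    ∑ k, conj (senderQubit k i) * senderQubit k i' = if i = i' then 1 else 0 := by
  have h3 := inv_sqrt_three_mul_self
  have h2 : conj (2 : ℂ) = 2 := map_ofNat _ 2
  simp only [Fintype.sum_sum_type, Fintype.sum_prod_type, senderQubit]
  fin_cases i <;> fin_cases i' <;> simp [h2]
  all_goals linear_combination 3 * h3

/-- The part on `ℂ^2` does not depend on `q`, and every block phase sums to zero over `q`. -/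
theorem sum_senderQubit_mul_senderBlock (γ₂ : ℂ) (i : Fin 2) (j c : Fin 3) :
    ∑ k, conj (senderQubit k i) * senderBlock γ₂ k j c = 0 := by
  have hphase : ∀ e, ∑ q, blockPhase γ₂ e q j = 0 := by
    intro e
    have h : ∀ z : ℂ, z ^ 2 = -1 ∨ z = -1 → ∑ q : Fin 4, z ^ (q : ℕ) = 0 := by
      rintro z (hz | rfl)
      · simp [Fin.sum_univ_succ]
        linear_combination (1 + z) * hz
      · simp [Fin.sum_univ_succ]
        norm_num
    fin_cases j
    · simp [blockPhase, ← Finset.sum_div, h Complex.I]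
    · simp [blockPhase, ← Finset.sum_div, h (-1)]
    · simp [blockPhase, ← Finset.sum_div, ← Finset.mul_sum, h Complex.I]
  simp only [Fintype.sum_sum_type, Fintype.sum_prod_type, senderQubit, senderBlock]
  have hzero : ∀ e p, ∑ q, (if c = p + ![0, 1, 0] j then blockPhase γ₂ e q j else 0) = 0 := by
    intro e p
    split_ifs
    · exact hphase e
    · simp
  rw [Finset.sum_eq_zero fun e _ => Finset.sum_eq_zero fun p _ => ?_]
  · simp
  · refine (Finset.mul_sum Finset.univ (fun q => if c = p + ![0, 1, 0] j then
      blockPhase γ₂ e q j else 0) (conj (if i = e then ((√3 : ℝ) : ℂ)⁻¹ / 2 else 0))).symm.trans ?_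
    rw [hzero, mul_zero]

theorem sum_senderBlock (h₂ : ‖γ₂‖ = 1) (j c j' c' : Fin 3) :
    ∑ k, conj (senderBlock γ₂ k j c) * senderBlock γ₂ k j' c' =
      if (j, c) = (j', c') then 1 else 0 := by
  have hl : ∑ e, ∑ p, ∑ q, conj (senderBlock γ₂ (Sum.inl (e, p, q)) j c) *
      senderBlock γ₂ (Sum.inl (e, p, q)) j' c' = if (j, c) = (j', c') then 2 / 9 else 0 := by
    calc _ = ∑ p, ((if c = p + ![0, 1, 0] j then (1 : ℂ) else 0) *
          (if c' = p + ![0, 1, 0] j' then 1 else 0)) *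
          ∑ e, ∑ q, conj (blockPhase γ₂ e q j) * blockPhase γ₂ e q j' := by
          rw [Finset.sum_comm]
          refine Finset.sum_congr rfl fun p _ => ?_
          simp only [Finset.mul_sum, senderBlock]
          refine Finset.sum_congr rfl fun e _ => Finset.sum_congr rfl fun q _ => ?_
          split_ifs <;> simp
      _ = _ := by
          rw [sum_blockPhase γ₂ h₂, ← Finset.sum_mul]
          by_cases hj : j = j'
          · subst hj
            rw [sum_shift]
            simp
          · simp [hj]
  have hr : ∑ p, ∑ q, conj (senderBlock γ₂ (Sum.inr (p, q)) j c) *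
      senderBlock γ₂ (Sum.inr (p, q)) j' c' = if (j, c) = (j', c') then 7 / 9 else 0 := by
    calc _ = ∑ p, ((if c = p + j then (1 : ℂ) else 0) * (if c' = p + j' then 1 else 0)) *
          ∑ q : Fin 3, conj (((√(7 / 27) : ℝ) : ℂ) * cubeRoot ^ ((q : ℕ) * (j : ℕ))) *
            (((√(7 / 27) : ℝ) : ℂ) * cubeRoot ^ ((q : ℕ) * (j' : ℕ))) := by
          refine Finset.sum_congr rfl fun p _ => ?_
          simp only [Finset.mul_sum, senderBlock]
          refine Finset.sum_congr rfl fun q _ => ?_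
          split_ifs <;> simp
      _ = _ := by
          rw [sum_cubeRoot, ← Finset.sum_mul]
          by_cases hj : j = j'
          · subst hj
            rw [sum_shift]
            simp
          · simp [hj]
  rw [Fintype.sum_sum_type, Fintype.sum_prod_type, Fintype.sum_prod_type]
  simp only [Fintype.sum_prod_type]
  rw [hl, hr]
  split_ifs
  · norm_num
  · norm_num

/-- Shifting by `m` only permutes the blocks, so completeness reduces to the unshifted rows, where
`2 / 9 + 7 / 9 = 1` on `ℂ^9`. -/
theorem isMeasurement_blockRow (h₂ : ‖γ₂‖ = 1) (m : Fin 3) :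
    IsMeasurement fun k => Matrix.replicateRow (Fin 1)
      (blockRow m (senderQubit k) (senderBlock γ₂ k)) := by
  refine isMeasurement_replicateRow fun i i' => ?_
  have hinj : ∀ b b' : Fin 9, (((blockIndex b).1 - m, (blockIndex b).2) : Fin 3 × Fin 3) =
      ((blockIndex b').1 - m, (blockIndex b').2) ↔ b = b' := by
    intro b b'
    rw [← blockIndex_injective.eq_iff (a := b), Prod.ext_iff, Prod.ext_iff, sub_left_inj]
  rcases i with ⟨i | b, z⟩ <;> rcases i' with ⟨i' | b', z'⟩ <;>
    simp only [blockRow, Sum.elim_inl, Sum.elim_inr, Subsingleton.elim z z']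
  · rw [sum_senderQubit]
    simp
  · rw [sum_senderQubit_mul_senderBlock]
    simp
  · have := congrArg conj
      (sum_senderQubit_mul_senderBlock γ₂ i' ((blockIndex b).1 - m) (blockIndex b).2)
    simp only [map_sum, map_mul, Complex.conj_conj, map_zero, mul_comm (senderQubit _ _)] at this
    rw [this]
    simp
  · rw [sum_senderBlock h₂]
    simp only [hinj]
    simp

/-- A row on one basis vector of `ℂ^2` has `X = Y = 0`, so only the overlap 02 needs correction. The
attenuated part on `ℂ^2` contributes `±γ₂ / 36`, which blocks 0 and 2, at the same position, cancel;
block 1 sits at another position. All squared norms are `1 / 36 + 1 / 36`. Rows without a part on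
`ℂ^2` put the three blocks at distinct positions. -/
theorem star_blockImage_dotProduct (h₁ : ‖γ₁‖ = 1) (h₂ : ‖γ₂‖ = 1) (k : SenderIndex) :
    ∃ τ : ℂ, ∀ l l', star (blockImage γ₁ γ₂ (senderQubit k) (senderBlock γ₂ k) l) ⬝ᵥ
      blockImage γ₁ γ₂ (senderQubit k) (senderBlock γ₂ k) l' = if l = l' then τ else 0 := by
  have g₁ := conj_mul_self_of_norm_eq_one h₁
  have g₂ := conj_mul_self_of_norm_eq_one h₂
  have h3 := inv_sqrt_three_mul_self
  have h6 : conj (6 : ℂ) = 6 := map_ofNat _ 6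
  have h22 : conj (2 : ℂ) = 2 := map_ofNat _ 2
  have hI : ∀ q : ℕ, (-Complex.I) ^ q * Complex.I ^ q = 1 := fun q => by simp [← mul_pow]
  have hneg : ∀ q : ℕ, (-1 : ℂ) ^ q * (-1) ^ q = 1 := fun q => by simp [← mul_pow]
  rcases k with ⟨e, p, q⟩ | ⟨p, q⟩
  · have hq := hI q
    have hq' := hneg q
    have h4 : ((√3 : ℝ) : ℂ)⁻¹ * (((√3 : ℝ) : ℂ)⁻¹ / 2) *
        (((√3 : ℝ) : ℂ)⁻¹ * (((√3 : ℝ) : ℂ)⁻¹ / 2)) = 1 / 36 := by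
      linear_combination (((√3 : ℝ) : ℂ)⁻¹ * ((√3 : ℝ) : ℂ)⁻¹ / 4 + 1 / 12) * h3
    refine ⟨1 / 18, eq_ite_of_hermitian (fun s s' => Matrix.star_dotProduct _ _) (fun s => ?_)
      ?_ ?_ ?_⟩
    · fin_cases s <;> fin_cases e <;>
        simp [dotProduct, blockImage, senderQubit, senderBlock, blockPhase, h6, h22]
      · linear_combination h4 + 1 / 36 * hq
      · linear_combination h4 + 1 / 36 * hq
      · linear_combination (conj γ₁ * γ₁) * h4 + 1 / 36 * g₁ + 1 / 36 * hq'
      · linear_combination (conj γ₁ * γ₁) * h4 + 1 / 36 * g₁ + 1 / 36 * hq'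
      · linear_combination (conj γ₂ * γ₂) * h4 + 1 / 36 * (conj γ₂ * γ₂) * hq + 1 / 18 * g₂
      · linear_combination (conj γ₂ * γ₂) * h4 + 1 / 36 * (conj γ₂ * γ₂) * hq + 1 / 18 * g₂
    · fin_cases e <;> simp [dotProduct, blockImage, senderQubit, senderBlock, blockPhase]
    · fin_cases e <;>
        simp [dotProduct, blockImage, senderQubit, senderBlock, blockPhase, h6, h22]
      · linear_combination γ₂ * h4 - 1 / 36 * γ₂ * hq
      · linear_combination -γ₂ * h4 + 1 / 36 * γ₂ * hq
    · fin_cases e <;> simp [dotProduct, blockImage, senderQubit, senderBlock, blockPhase]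
  · have hz : ∀ l, blockImage γ₁ γ₂ (senderQubit (Sum.inr (p, q)))
        (senderBlock γ₂ (Sum.inr (p, q))) l =
          Sum.elim (0 : Fin 2 → ℂ) (senderBlock γ₂ (Sum.inr (p, q)) l) := by
      intro l
      funext i
      rcases i with i | i
      · fin_cases l <;> simp [blockImage, senderQubit]
      · rfl
    have h7 : ((√(7 / 27) : ℝ) : ℂ) * ((√(7 / 27) : ℝ) : ℂ) = 7 / 27 := by
      rw [← Complex.ofReal_mul, Real.mul_self_sqrt (by norm_num)]
      norm_num
    have h3 : cubeRoot ^ 3 = 1 := by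
      linear_combination (cubeRoot - 1) * one_add_cubeRoot_add_sq
    refine ⟨7 / 27, fun l l' => ?_⟩
    simp only [hz]
    by_cases hl : l = l'
    · subst hl
      simp [dotProduct, senderBlock, conj_cubeRoot, -Complex.ofReal_div, -Real.sqrt_div]
      rw [mul_mul_mul_comm, ← mul_pow, ← Complex.ofReal_mul]
      rw [← pow_succ, h3, one_pow, mul_one, ← Real.sqrt_div (by norm_num), Complex.ofReal_mul, h7]
    · simp [dotProduct, senderBlock, hl, Ne.symm hl]

theorem exists_isLOCC_no_ebit (h₁ : ‖γ₁‖ = 1) (h₂ : ‖γ₂‖ = 1) :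
    ∃ Λ : BipartiteMap (C11 × Fin 1) (C11 × Fin 1) (Fin 1) ((C11 × C11) × Fin 1),
      IsLOCC [(Party.B, 3), (Party.A, 33)] Λ ∧
        1 ≤ outputFidelity Λ (initialState (psiRAB γ₁ γ₂) 1) (targetState (psiRAB γ₁ γ₂) 1) := by
  rw [← sum_normSq_initialState h₁ h₂ (show 0 < 1 by norm_num)]
  refine exists_isLOCC_receiver_sender (κ := SenderIndex) (by simp)
    (fun m => diagonalOperator (blockWeight m))
    (isMeasurement_diagonalOperator sum_blockWeight)
    (fun m k => blockRow m (senderQubit k) (senderBlock γ₂ k)) (isMeasurement_blockRow h₂) _ _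
    (fun s s' => ?_) fun m k => ?_
  · rw [star_targetState_dotProduct, star_psiAB_dotProduct h₁ h₂]
    simp
  · obtain ⟨τ, hτ⟩ := star_blockImage_dotProduct h₁ h₂ k
    set c : ℂ := ((√33 : ℝ) : ℂ)⁻¹ * ((√((1 : ℕ) : ℝ) : ℝ) : ℂ)⁻¹ with hc
    have hstar : star c = c := by
      simp only [hc, star_mul', Complex.star_def, map_inv₀, Complex.conj_ofReal]
    refine ⟨c * c * τ, fun s s' => ?_⟩
    rw [← mul_zero (c * c), ← mul_ite, ← hτ, ← star_blockWeight_mul_rowImage m]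
    have hmove : ∀ s i, ∑ t, blockRow m (senderQubit k) (senderBlock γ₂ k) t *
        (diagonalOperator (blockWeight m) *ᵥ
          fun j => initialState (psiRAB γ₁ γ₂) 1 (s, t, j)) i =
        (fun j : C11 × Fin 1 => c * (blockWeight m j * rowImage γ₁ γ₂ (fun a =>
          blockRow m (senderQubit k) (senderBlock γ₂ k) (a, j.2)) s j.1))
            ((Fintype.equivFin (C11 × Fin 1)).symm i) := by
      intro s i
      simp only [diagonalOperator_mulVec]
      rw [mul_left_comm, hc, ← sum_mul_initialState, Finset.mul_sum]
      exact Finset.sum_congr rfl fun t _ => mul_left_comm _ _ _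
    simp only [hmove, dotProduct, Pi.star_apply, star_mul', hstar, Finset.mul_sum]
    rw [← (Fintype.equivFin (C11 × Fin 1)).symm.sum_comp]
    refine Finset.sum_congr rfl fun i _ => ?_
    ring

end

end StateMerging

end

/-! ### The main theorem -/

theorem mainTheorem1 (γ₁ γ₂ : ℂ) (hγ₁ : ‖γ₁‖ = 1) (hγ₂ : ‖γ₂‖ = 1)
    (hγ₁_nonreal : γ₁.im ≠ 0) (hγ₂_nonreal : γ₂.im ≠ 0)
    (hγ_pos : γ₂ ≠ Complex.I * γ₁ ^ 2) (hγ_neg : γ₂ ≠ -(Complex.I * γ₁ ^ 2)) :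
    (∀ l l' : Fin 3, star (psiAB γ₁ γ₂ l) ⬝ᵥ psiAB γ₁ γ₂ l' = if l = l' then 1 else 0) ∧
    ∃ ε₀ : ℝ, 0 < ε₀ ∧ ∀ ε ∈ Set.Icc (0 : ℝ) ε₀,
      IsLeast (nonCatalyticCosts OneWayLOCC (psiRAB γ₁ γ₂) ε) 1 ∧
      IsLeast (nonCatalyticCosts (OneWayLOCCFrom Party.A) (psiRAB γ₁ γ₂) ε) 1 ∧
      IsLeast (nonCatalyticCosts TwoWayLOCC (psiRAB γ₁ γ₂) ε) 0 ∧
      ∃ Λ : BipartiteMap (C11 × Fin 1) (C11 × Fin 1) (Fin 1) ((C11 × C11) × Fin 1),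
        TwoWayLOCC _ _ _ _ Λ ∧
        LOCCWithRounds [(Party.B, 3), (Party.A, 33)] _ _ _ _ Λ ∧
        AchievesMerging (psiRAB γ₁ γ₂) 1 1 ε Λ := by
  have nonneg_logb : ∀ K : ℕ, 0 < K → 0 ≤ Real.logb 2 K := fun K hK =>
    Real.logb_nonneg (by norm_num) (by exact_mod_cast hK)
  refine ⟨star_psiAB_dotProduct hγ₁ hγ₂, ?_⟩
  obtain ⟨δ, hδ, hbound⟩ := exists_forall_outputFidelity_le hγ₁ hγ₂ hγ_pos hγ_neg
  -- Half of the gap makes `ε² < δ` strict, so one-way merging with `K = 1` fails. The same bound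
  -- certifies that the two-round map is not one-way.
  refine ⟨√(δ / 2), by positivity, fun ε hε => ?_⟩
  have hε2 : ε ^ 2 < δ := by
    calc ε ^ 2 ≤ √(δ / 2) ^ 2 := pow_le_pow_left₀ hε.1 hε.2 2
      _ = δ / 2 := Real.sq_sqrt (by positivity)
      _ < δ := by linarith
  have not_oneWay : ∀ Λ : BipartiteMap (C11 × Fin 1) (C11 × Fin 1) (Fin 1) ((C11 × C11) × Fin 1),
      AchievesMerging (psiRAB γ₁ γ₂) 1 1 ε Λ → ¬ OneWayLOCC _ _ _ _ Λ := by
    intro Λ hΛ h1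
    have h2 : 1 - ε ^ 2 ≤ outputFidelity Λ _ _ := hΛ
    linarith [hbound Λ h1]
  have one_le : ∀ c ∈ nonCatalyticCosts OneWayLOCC (psiRAB γ₁ γ₂) ε, 1 ≤ c := by
    rintro c ⟨K, hK, rfl, Λ, hΛ, hmerge⟩
    have hK1 : K ≠ 1 := by
      rintro rfl
      exact not_oneWay Λ hmerge hΛ
    rw [Real.le_logb_iff_rpow_le (by norm_num) (by exact_mod_cast hK), Real.rpow_one]
    exact_mod_cast (show 2 ≤ K by omega)
  have one_mem : (1 : ℝ) ∈ nonCatalyticCosts (OneWayLOCCFrom Party.A) (psiRAB γ₁ γ₂) ε := by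
    obtain ⟨Λ, hΛ, hfid⟩ := exists_isLOCC_one_ebit hγ₁ hγ₂
    refine ⟨2, by norm_num, by simp, Λ, ⟨22, hΛ⟩, ?_⟩
    exact le_trans (by linarith [sq_nonneg ε]) hfid
  have sub : nonCatalyticCosts (OneWayLOCCFrom Party.A) (psiRAB γ₁ γ₂) ε ⊆
      nonCatalyticCosts OneWayLOCC (psiRAB γ₁ γ₂) ε := by
    rintro c ⟨K, hK, hc, Λ, hΛ, hmerge⟩
    exact ⟨K, hK, hc, Λ, ⟨Party.A, hΛ⟩, hmerge⟩
  obtain ⟨Λ, hΛ, hfid⟩ := exists_isLOCC_no_ebit hγ₁ hγ₂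
  have hmerge : AchievesMerging (psiRAB γ₁ γ₂) 1 1 ε Λ :=
    le_trans (by linarith [sq_nonneg ε]) hfid
  have htwo : TwoWayLOCC _ _ _ _ Λ := ⟨⟨_, hΛ⟩, not_oneWay Λ hmerge⟩
  refine ⟨⟨sub one_mem, one_le⟩, ⟨one_mem, fun c hc => one_le c (sub hc)⟩,
    ⟨⟨1, one_pos, by simp, Λ, htwo, hmerge⟩, ?_⟩, Λ, htwo, hΛ, hmerge⟩
  rintro c ⟨K, hK, rfl, -⟩
  exact nonneg_logb K hK
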